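/- **Setting.** Let $\mathcal S,\mathcal A$ be finite sets, $P(\cdot\mid s,a)$ a transition kernel, $\nu_0$ an initial distribution on $\mathcal S$ and $\gamma\in[0,1)$. For a policy $\pi$ (a map from states to distributions on $\mathcal A$) let $d^\pi(s,a)=(1-\gamma)\sum_{h\ge 0}\gamma^h\,\mathbb P[(s,a)\text{ is visited after }h\text{ steps acting with }\pi]$. The MDP is *linear*: there are a feature matrix $\Phi\in\mathbb R^{|\mathcal S||\mathcal A|\times d}$ with rows $\phi(s,a)$, known to the learner, and an unknown matrix $M\in\mathbb R^{d\times|\mathcal S|}$ with $P=\Phi M$, and every row of $\Phi$ and of $M$ has $\ell^1$-norm at most $1$. The costs are $c^k=\Phi\mathbf w^k$ with $\|\mathbf w^k\|_2\le 1$, $k=1,\dots,K$, $K\ge1$; they are revealed in full and chosen by an adversary, $\mathbf w^k$ being allowed to depend on all datasets collected up to and including the batch of episode $k$. **Algorithm** (batch size $\tau\ge 1$, exploration parameter $\beta$, step size $\eta>0$). Put $V^1=0$, $Q^1=0$ and let $\pi^{(1)}$ be uniform. For $j=1,\dots,\lfloor K/\tau\rfloor$, with $T_j=\{(j-1)\tau+1,\dots,j\tau\}$: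 draw a dataset $\mathcal D^{(j)}$ of $\tau$ independent transitions $(s,a,s')$ with $(s,a)\sim d^{\pi^{(j)}}$ and $s'\sim P(\cdot\mid s,a)$; set $\Lambda^{(j)}=I+\sum_{(s,a)\in\mathcal D^{(j)}}\phi(s,a)\phi(s,a)^\top$ and $b^{(j)}(s,a)=\beta\|\phi(s,a)\|_{(\Lambda^{(j)})^{-1}}$; for $k\in T_j$ in increasing order set $$\mathbf v^k=(\Lambda^{(j)})^{-1}\sum_{(s,a,s')\in\mathcal D^{(j)}}\phi(s,a)V^k(s'),\quad Q^{k+1}=\big[c^k+\gamma\Phi\mathbf v^k-b^{(j)}\big]_{-(1-\gamma)^{-1}}^{(1-\gamma)^{-1}},\quad V^{k+1}(s)=\langle\pi^{(j)}(\cdot\mid s),Q^{k+1}(s,\cdot)\rangle$$ (the brackets denote clipping); finally set $\bar Q^{(j)}=\frac1\tau\sum_{k\in T_j}Q^k$ and $\pi^{(j+1)}(a\mid s)\propto\exp\big(-\eta\sum_{i\le j}\bar Q^{(i)}(s,a)\big)$. The policy of episode $k$ is $\pi^k=\pi^{(\lceil k/\tau\rceil)}$. Write $$L_{K,\tau,\delta}=\frac{d}{1-\gamma}\log\frac{R\,d}{1-\gamma},\qquad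 R=\frac{\tau K\sqrt d}{\delta(1-\gamma)}.$$ **Theorem.** There are universal constants $C,C'>0$ such that the following holds for every such linear MDP, every $K\ge 1$ and every $\delta\in(0,1)$. 1. Let $\tau\le K/\sqrt\tau$, $\eta>0$ and $\beta\ge C\,L_{K,\tau,\delta}$ (so that $\beta=\widetilde{\mathcal O}(d/(1-\gamma))$ is allowed). Then for every such adversary and every comparator policy $\pi^\star$, with probability at least $1-2\delta$, $$\sum_{k=1}^K\langle d^{\pi^k}-d^{\pi^\star},c^k\rangle\le\frac{\tau\log|\mathcal A|}{\eta}+\frac{\tau+1}{1-\gamma}+\frac{\eta K}{(1-\gamma)^2}+12\beta K\sqrt{\frac d\tau}\,\log\Big(\frac{2Kd}{\tau\delta}\Big)+\frac{\sqrt{2\eta}\,K}{(1-\gamma)^2\tau}.$$ 2. In particular the regret is $\widetilde{\mathcal O}(K^{3/4})$: with $\tau=\lfloor\sqrt K\rfloor$, $\beta=C\,L_{K,\tau,\delta}$ and $\eta=(1-\gamma)\sqrt{\tau(1+\log|\mathcal A|)/K}$, for every such adversary and every comparator policy $\pi^\star$, with probability at least $1-2\delta$, $$\sum_{k=1}^K\langle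 d^{\pi^k}-d^{\pi^\star},c^k\rangle\le C'\,\frac{d^{3/2}\sqrt{1+\log|\mathcal A|}}{(1-\gamma)^2}\,K^{3/4}\,\log^2\Big(\frac{2Kd}{\delta(1-\gamma)}\Big).$$ -/

import Mathlib

namespace AdvLinMDP

open scoped ENNReal

noncomputable section

/-- A discounted Markov decision process without its cost function. -/
structure MDP (S A : Type*) where
  /-- the transition kernel `P(· | s, a)` -/
  P : S → A → PMF S
  /-- the initial state distribution -/
  ν₀ : PMF S
  /-- the discount factor -/
  γ : ℝ
  γ_nonneg : 0 ≤ γ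
  γ_lt_one : γ < 1

/-- A stationary stochastic policy `s ↦ π(· | s)`. -/
abbrev Policy (S A : Type*) := S → PMF A

/-- A feature matrix, whose rows `φ(s, a)` are indexed by the state-action pairs. -/
abbrev Features (S A : Type*) (d : ℕ) := Matrix (S × A) (Fin d) ℝ

/-- A dataset of `τ` transitions `(s, a, s')`. -/
abbrev Batch (S A : Type*) (τ : ℕ) := Fin τ → S × A × S

/-- The transition matrix factorizes as `P = Φ M`, where all rows of `Φ` and of `M` have
`ℓ¹`-norm at most one. -/
def IsLinear {S A : Type*} [Fintype S] {d : ℕ} (m : MDP S A) (Φ : Features S A d) : Prop :=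
  (∀ x, ∑ i, |Φ x i| ≤ 1) ∧
  ∃ M : Matrix (Fin d) S ℝ, (∀ i, ∑ s, |M i s| ≤ 1) ∧
    ∀ s a s', (m.P s a s').toReal = (Φ * M) (s, a) s'

/-- The cost vector `Φ w`. -/
def linCost {S A : Type*} {d : ℕ} (Φ : Features S A d) (w : EuclideanSpace ℝ (Fin d)) :
    S × A → ℝ :=
  fun x => ∑ i, Φ x i * w i

/-! ### Occupancy measures -/

section Occupancy

variable {S A : Type*}

/-- The law of the state-action pair visited after `h` steps acting with `π`. -/
def visit (m : MDP S A) (π : Policy S A) : ℕ → PMF (S × A)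
  | 0 => m.ν₀.bind fun s => (π s).map fun a => (s, a)
  | h + 1 => (visit m π h).bind fun x => (m.P x.1 x.2).bind fun s' => (π s').map fun a => (s', a)

/-- The discounted occupancy measure
`d^π(s, a) = (1 - γ) ∑ₕ γʰ ℙ[(s, a) is visited after h steps acting with π]`. -/
def occupancy (m : MDP S A) (π : Policy S A) (x : S × A) : ℝ :=
  (1 - m.γ) * ∑' h : ℕ, m.γ ^ h * (visit m π h x).toReal

/-- The length of a rollout that is stopped with probability `1 - γ` after each step. -/
def stopTime (m : MDP S A) : PMF ℕ :=
  ⟨fun h => ENNReal.ofReal ((1 - m.γ) * m.γ ^ h), by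
    have h1 : HasSum (fun h : ℕ => (1 - m.γ) * m.γ ^ h) 1 := by
      have h2 := (hasSum_geometric_of_lt_one m.γ_nonneg m.γ_lt_one).mul_left (1 - m.γ)
      rwa [mul_inv_cancel₀ (by linarith [m.γ_lt_one])] at h2
    have h3 := h1.summable
    have h4 : ∀ h : ℕ, 0 ≤ (1 - m.γ) * m.γ ^ h := fun h =>
      mul_nonneg (by linarith [m.γ_lt_one]) (pow_nonneg m.γ_nonneg h)
    have h5 := ENNReal.ofReal_tsum_of_nonneg h4 h3
    rw [h1.tsum_eq, ENNReal.ofReal_one] at h5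
    rw [h5]
    exact ENNReal.summable.hasSum⟩

/-- The sampler from `d^π`: roll out `π`, stopping with probability `1 - γ` after each step, and
return the last state-action pair. -/
def sampleOccupancy (m : MDP S A) (π : Policy S A) : PMF (S × A) :=
  (stopTime m).bind (visit m π)

/-- The output of the sampler is distributed according to `d^π`. -/
theorem toReal_sampleOccupancy (m : MDP S A) (π : Policy S A) (x : S × A) :
    (sampleOccupancy m π x).toReal = occupancy m π x := by
  have h4 : ∀ h : ℕ, 0 ≤ (1 - m.γ) * m.γ ^ h := fun h =>
    mul_nonneg (by linarith [m.γ_lt_one]) (pow_nonneg m.γ_nonneg h)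
  rw [sampleOccupancy, PMF.bind_apply, ENNReal.tsum_toReal_eq, occupancy, ← tsum_mul_left]
  · refine tsum_congr fun h => ?_
    rw [ENNReal.toReal_mul]
    change (ENNReal.ofReal ((1 - m.γ) * m.γ ^ h)).toReal * _ = _
    rw [ENNReal.toReal_ofReal (h4 h), mul_assoc]
  · intro h
    exact ENNReal.mul_ne_top ENNReal.ofReal_ne_top (PMF.apply_ne_top _ _)

/-- The law of a transition `(s, a, s')` with `(s, a) ∼ d^π` and `s' ∼ P(· | s, a)`. -/
def sampleTransition (m : MDP S A) (π : Policy S A) : PMF (S × A × S) :=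
  (sampleOccupancy m π).bind fun x => (m.P x.1 x.2).map fun s' => (x.1, x.2, s')

end Occupancy

/-- The law of `n` independent samples from `p`. -/
def iid {α : Type*} (p : PMF α) : (n : ℕ) → PMF (Fin n → α)
  | 0 => PMF.pure Fin.elim0
  | n + 1 => p.bind fun x => (iid p n).map fun y => Fin.cons x y

/-! ### The algorithm -/

section Algorithm

variable {S A : Type*} {d : ℕ}

/-- The policy `π(a | s) ∝ exp(-η f(s, a))`. -/
def softmaxPolicy [Fintype A] [Nonempty A] (η : ℝ) (f : S × A → ℝ) : Policy S A := fun s =>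
  PMF.normalize (fun a => ENNReal.ofReal (Real.exp (-η * f (s, a))))
    (by
      rw [tsum_fintype]
      intro h
      obtain ⟨a⟩ := ‹Nonempty A›
      have := (Finset.sum_eq_zero_iff.mp h) a (Finset.mem_univ a)
      rw [ENNReal.ofReal_eq_zero] at this
      exact absurd (Real.exp_pos (-η * f (s, a))) (not_lt.mpr this))
    (by
      rw [tsum_fintype]
      exact ENNReal.sum_ne_top.mpr fun a _ => ENNReal.ofReal_ne_top)

/-- The regularized covariance matrix `Λ = ∑ φ(s, a) φ(s, a)ᵀ + I` of a dataset. -/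
def covariance {τ : ℕ} (Φ : Features S A d) (D : Batch S A τ) : Matrix (Fin d) (Fin d) ℝ :=
  ∑ i, Matrix.vecMulVec (Φ ((D i).1, (D i).2.1)) (Φ ((D i).1, (D i).2.1)) + 1

/-- The exploration bonus `b(s, a) = β ‖φ(s, a)‖_{Λ⁻¹}`. -/
def bonus {τ : ℕ} (Φ : Features S A d) (β : ℝ) (D : Batch S A τ) (x : S × A) : ℝ :=
  β * √(Φ x ⬝ᵥ (covariance Φ D)⁻¹.mulVec (Φ x))

/-- The least-squares estimate `v = Λ⁻¹ ∑ φ(s, a) V(s')`. -/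
def regress {τ : ℕ} (Φ : Features S A d) (D : Batch S A τ) (V : S → ℝ) : Fin d → ℝ :=
  (covariance Φ D)⁻¹.mulVec (∑ i, V (D i).2.2 • Φ ((D i).1, (D i).2.1))

/-- The optimistic update `c + γ Φ v - b`, clipped to `[-(1 - γ)⁻¹, (1 - γ)⁻¹]`. -/
def optimisticQ {τ : ℕ} (γ β : ℝ) (Φ : Features S A d) (D : Batch S A τ) (c : S × A → ℝ)
    (V : S → ℝ) (x : S × A) : ℝ :=
  max (-(1 - γ)⁻¹) (min (1 - γ)⁻¹ (c x + γ * (Φ x ⬝ᵥ regress Φ D V) - bonus Φ β D x))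

/-- The iterates `(Q, V)` of the policy evaluation loop inside one batch, with dataset `D`, policy
`π`, costs `c 0, c 1, …` and initial value `QV`. -/
def evalIter [Fintype A] {τ : ℕ} (γ β : ℝ) (Φ : Features S A d) (D : Batch S A τ)
    (π : Policy S A) (c : ℕ → S × A → ℝ) (QV : (S × A → ℝ) × (S → ℝ)) :
    ℕ → (S × A → ℝ) × (S → ℝ)
  | 0 => QV
  | n + 1 =>
    let Q := optimisticQ γ β Φ D (c n) (evalIter γ β Φ D π c QV n).2
    (Q, fun s => ∑ a, (π s a).toReal * Q (s, a))

/-- What the learner remembers between two batches: the sum of the batch averages of the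
`Q`-functions, and the current iterates `Q` and `V`. -/
structure LearnerState (S A : Type*) where
  /-- the sum of the averaged `Q`-functions of the batches seen so far -/
  sumQ : S × A → ℝ
  /-- the current `Q`-function -/
  Q : S × A → ℝ
  /-- the current value function -/
  V : S → ℝ

/-- The adversary chooses the weight of the cost of each episode from the datasets collected up to
and including the batch of that episode (newest dataset first). Episodes are counted from `0`. -/
abbrev Adversary (S A : Type*) (d τ : ℕ) := ℕ → List (Batch S A τ) → EuclideanSpace ℝ (Fin d)

/-- The learner's state after the datasets in the list (newest first) have been processed. -/
def learner [Fintype A] [Nonempty A] {τ : ℕ} (γ β η : ℝ) (Φ : Features S A d)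
    (w : Adversary S A d τ) : List (Batch S A τ) → LearnerState S A
  | [] => ⟨0, 0, 0⟩
  | D :: H =>
    let st := learner γ β η Φ w H
    let it := evalIter γ β Φ D (softmaxPolicy η st.sumQ)
      (fun n => linCost Φ (w (H.length * τ + n) (D :: H))) (st.Q, st.V)
    { sumQ := fun x => st.sumQ x + (τ : ℝ)⁻¹ * ∑ n ∈ Finset.range τ, (it n).1 x
      Q := (it τ).1
      V := (it τ).2 }

/-- The policy `π^{(j)}` that the learner plays after the datasets in `H` have been processed. -/
def learnerPolicy [Fintype A] [Nonempty A] {τ : ℕ} (γ β η : ℝ) (Φ : Features S A d)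
    (w : Adversary S A d τ) (H : List (Batch S A τ)) : Policy S A :=
  softmaxPolicy η (learner γ β η Φ w H).sumQ

/-- The law of the first `n` datasets (newest first): given the previous ones, a dataset consists
of `τ` independent transitions sampled from the occupancy measure of the current policy. -/
def historyLaw [Fintype A] [Nonempty A] (m : MDP S A) (β η : ℝ) (Φ : Features S A d) {τ : ℕ}
    (w : Adversary S A d τ) : ℕ → PMF (List (Batch S A τ))
  | 0 => PMF.pure []
  | n + 1 => (historyLaw m β η Φ w n).bind fun H =>
      (iid (sampleTransition m (learnerPolicy m.γ β η Φ w H)) τ).map fun D => D :: H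

/-- `∑ₖ ⟨d^{π^k} - d^{π⋆}, c^k⟩` over `K` episodes, for the datasets in `H` (newest first). Episode
`k` belongs to the batch `k / τ`: its policy is computed from the `k / τ` oldest datasets
and its cost may depend on the `k / τ + 1` oldest ones. -/
def regretSum [Fintype S] [Fintype A] [Nonempty A] (m : MDP S A) (β η : ℝ) (Φ : Features S A d)
    {τ : ℕ} (w : Adversary S A d τ) (π' : Policy S A) (K : ℕ) (H : List (Batch S A τ)) : ℝ :=
  ∑ k ∈ Finset.range K, ∑ x : S × A,
    (occupancy m (learnerPolicy m.γ β η Φ w (H.rtake (k / τ))) x - occupancy m π' x) *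
      linCost Φ (w k (H.rtake (k / τ + 1))) x

/-- The probability that the algorithm, run for `K` episodes with batches of size `τ`,
satisfies `∑ₖ ⟨d^{π^k} - d^{π⋆}, c^k⟩ ≤ bound`. -/
def probRegretLe [Fintype S] [Fintype A] [Nonempty A] (m : MDP S A) (β η : ℝ)
    (Φ : Features S A d) {τ : ℕ} (w : Adversary S A d τ) (π' : Policy S A) (K : ℕ)
    (bound : ℝ) : ℝ≥0∞ :=
  (historyLaw m β η Φ w (K / τ)).toOuterMeasure {H | regretSum m β η Φ w π' K H ≤ bound}

end Algorithm

/-- The order `d / (1 - γ) · log (R d / (1 - γ))`, with `R = τ K √d / (δ (1 - γ))`, of the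
exploration parameter. -/
def explorationScale (d K τ : ℕ) (γ δ : ℝ) : ℝ :=
  d / (1 - γ) * Real.log (τ * K * √d / (δ * (1 - γ)) * d / (1 - γ))

/-- The regret bound. -/
def regretBound (d nA K τ : ℕ) (γ β η δ : ℝ) : ℝ :=
  τ * Real.log nA / η + (τ + 1) / (1 - γ) + η * K / (1 - γ) ^ 2
    + 12 * β * K * √(d / τ) * Real.log (2 * K * d / (τ * δ))
    + √(2 * η) * K / ((1 - γ) ^ 2 * τ)

end

end AdvLinMDP

/-! Write `B = (1-γ)⁻¹`. The policy is frozen inside a batch, while Q and V are updated by one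
optimistic Bellman step per episode. Suppose the bonus dominates every regression error. Then each
update satisfies `c + γPV - 2b ≤ Q⁺ ≤ c + γPV`. Pairing these bounds with the Bellman flow equations
of the learner and of the comparator, the initial-distribution terms cancel, and the regret of an
episode is at most `⟨d^π, V⁺ - V⟩ + 2⟨d^π, b⟩ - ⟨d^⋆, Q⁺⟩ + ⟨d^⋆, V⟩` (`avg_cost_sub_le`). The
V-differences telescope under the fixed `d^π`. Splitting off `⟨d^⋆, Q - Q⁺⟩`, which also telescopes,
leaves `⟨d^⋆, V - Q⟩`, the loss controlled by exponential weights, because V is the policy average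
of Q. At a batch change the policy moves by `O(ηB)` in total variation and the occupancy measure by
`O(ηB²)`, so the whole sum becomes a difference of one potential plus bonuses and a drift
(`batch_regret_le`).

Two probabilistic facts remain. First, the bonus must dominate the regression error although the
adversary sees the dataset. Given the past, the policy of the batch is fixed, and every value
function used is either the inherited one or is described by `d + d²` bounded parameters
(`batchIter_eq_candidateValue`). The error is ridge bias plus noise linear in a direction of `ℝ^d`.
An exponential moment bound for each direction and value function, a union bound over a grid, and a
perturbation estimate give uniform control without any dependence on the numbers of states and
actions (`avg_indicator_regress_le`).

Second, the bonuses must be small on average. A fresh sample is exchangeable with the `τ` samples of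
the dataset, and the squared norms of the samples in `Λ⁻¹` sum to at most `d`, so the expected width
is at most `√(2d/τ)`. An exponential supermartingale turns this into a high-probability bound on the
summed widths (`ex_exp_sumWidth_le`).

If the claimed bound exceeds `2K` it is trivial; otherwise `β² ≤ τ`, which makes the discretization
error a constant and the drift small. -/

namespace AdvLinMDP

open scoped ENNReal

noncomputable section

/-! ### Expectations under probability mass functions -/

section Expectation

variable {α β : Type*}

/-- The expectation of a real function on a finite type. -/
def avg [Fintype α] (p : PMF α) (f : α → ℝ) : ℝ := ∑ x, (p x).toReal * f x

section Finite

variable [Fintype α] [Fintype β] (p : PMF α)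

theorem sum_toReal_eq_one : ∑ x, (p x).toReal = 1 := by
  rw [← ENNReal.toReal_sum fun x _ => p.apply_ne_top x, ← tsum_fintype (L := .unconditional _),
    p.tsum_coe, ENNReal.toReal_one]

theorem avg_const (c : ℝ) : avg p (fun _ => c) = c := by
  rw [avg, ← Finset.sum_mul, sum_toReal_eq_one, one_mul]

theorem avg_mono {f g : α → ℝ} (h : ∀ x, f x ≤ g x) : avg p f ≤ avg p g :=
  Finset.sum_le_sum fun x _ => mul_le_mul_of_nonneg_left (h x) ENNReal.toReal_nonneg

theorem avg_nonneg {f : α → ℝ} (h : ∀ x, 0 ≤ f x) : 0 ≤ avg p f :=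
  Finset.sum_nonneg fun x _ => mul_nonneg ENNReal.toReal_nonneg (h x)

theorem avg_add (f g : α → ℝ) : avg p (fun x => f x + g x) = avg p f + avg p g := by
  simp only [avg, mul_add, Finset.sum_add_distrib]

theorem avg_sub (f g : α → ℝ) : avg p (fun x => f x - g x) = avg p f - avg p g := by
  simp only [avg, mul_sub, Finset.sum_sub_distrib]

theorem avg_const_mul (c : ℝ) (f : α → ℝ) : avg p (fun x => c * f x) = c * avg p f := by
  simp only [avg, Finset.mul_sum]
  exact Finset.sum_congr rfl fun x _ => by ring

theorem avg_sum {ι : Type*} (s : Finset ι) (f : ι → α → ℝ) :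
    avg p (fun x => ∑ i ∈ s, f i x) = ∑ i ∈ s, avg p (f i) := by
  simp only [avg, Finset.mul_sum]
  exact Finset.sum_comm

theorem abs_avg_le {f : α → ℝ} {B : ℝ} (h : ∀ x, |f x| ≤ B) : |avg p f| ≤ B := by
  rw [abs_le]
  constructor
  · rw [← avg_const p (-B)]
    exact avg_mono p fun x => (abs_le.mp (h x)).1
  · rw [← avg_const p B]
    exact avg_mono p fun x => (abs_le.mp (h x)).2

theorem abs_avg_sub_avg_le {f g : α → ℝ} {B : ℝ} (h : ∀ x, |f x - g x| ≤ B) :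
    |avg p f - avg p g| ≤ B := by
  rw [← avg_sub]
  exact abs_avg_le p h

theorem toReal_bind_apply {α β : Type*} [Fintype α] (p : PMF α) (q : α → PMF β) (y : β) :
    (p.bind q y).toReal = avg p fun x => (q x y).toReal := by
  rw [PMF.bind_apply, tsum_fintype, ENNReal.toReal_sum fun x _ =>
    ENNReal.mul_ne_top (p.apply_ne_top x) ((q x).apply_ne_top y)]
  simp only [ENNReal.toReal_mul, avg]

theorem avg_bind (q : α → PMF β) (f : β → ℝ) :
    avg (p.bind q) f = avg p fun x => avg (q x) f := by
  simp only [avg, toReal_bind_apply, Finset.sum_mul, Finset.mul_sum]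
  rw [Finset.sum_comm]
  exact Finset.sum_congr rfl fun x _ => Finset.sum_congr rfl fun y _ => by ring

theorem avg_pure (a : α) (f : α → ℝ) : avg (PMF.pure a) f = f a := by
  classical
  rw [avg, Finset.sum_eq_single a]
  · simp
  · intro b _ hb
    simp [PMF.pure_apply, hb]
  · simp

theorem avg_map (g : α → β) (f : β → ℝ) : avg (p.map g) f = avg p fun x => f (g x) := by
  rw [← PMF.bind_pure_comp, avg_bind]
  simp only [Function.comp, avg_pure]

/-- Hoeffding's lemma. -/
theorem avg_exp_mul_le {f : α → ℝ} {B : ℝ} (h : ∀ x, |f x| ≤ B) (t : ℝ) :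
    avg p (fun x => Real.exp (t * f x)) ≤ Real.exp (t * avg p f + B ^ 2 * t ^ 2 / 2) := by
  let _ : MeasurableSpace α := ⊤
  have hint : ∀ g : α → ℝ, ∫ x, g x ∂p.toMeasure = avg p g := fun g => by
    rw [PMF.integral_eq_sum]
    rfl
  have hs := (ProbabilityTheory.hasSubgaussianMGF_of_mem_Icc (μ := p.toMeasure) (X := f)
    (a := -B) (b := B) (measurable_of_finite f).aemeasurable
    (Filter.Eventually.of_forall fun x => abs_le.mp (h x))).mgf_le t
  rw [ProbabilityTheory.mgf, hint, hint] at hs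
  have hB : 0 ≤ B := by
    obtain ⟨x, -⟩ := p.support_nonempty
    exact (abs_nonneg _).trans (h x)
  have hc : (((‖B - -B‖₊ / 2) ^ 2 : NNReal) : ℝ) = B ^ 2 := by
    push_cast
    rw [Real.norm_eq_abs, sub_neg_eq_add, abs_of_nonneg (by linarith)]
    ring
  rw [hc] at hs
  calc avg p (fun x => Real.exp (t * f x))
      = Real.exp (t * avg p f) * avg p (fun x => Real.exp (t * (f x - avg p f))) := by
        rw [← avg_const_mul]
        congr 1
        funext x
        rw [← Real.exp_add]
        congr 1
        ring
    _ ≤ _ := by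
        rw [Real.exp_add]
        exact mul_le_mul_of_nonneg_left hs (Real.exp_pos _).le

end Finite

/-- The expectation of a function with values in `[0, ∞]`. -/
def ex (p : PMF α) (f : α → ℝ≥0∞) : ℝ≥0∞ := ∑' x, p x * f x

/-- Restricting to the support matters because the histories drawn by the algorithm have a known
length only there. -/
theorem ex_mono_on_support (p : PMF α) {f g : α → ℝ≥0∞} (h : ∀ x ∈ p.support, f x ≤ g x) :
    ex p f ≤ ex p g := by
  refine ENNReal.tsum_le_tsum fun x => ?_
  by_cases hx : p x = 0
  · simp [hx]
  · exact mul_le_mul_right (h x ((p.mem_support_iff x).mpr hx)) _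

theorem ex_mono (p : PMF α) {f g : α → ℝ≥0∞} (h : ∀ x, f x ≤ g x) : ex p f ≤ ex p g :=
  ex_mono_on_support p fun x _ => h x

theorem ex_const (p : PMF α) (c : ℝ≥0∞) : ex p (fun _ => c) = c := by
  rw [ex, ENNReal.tsum_mul_right, p.tsum_coe, one_mul]

theorem ex_add (p : PMF α) (f g : α → ℝ≥0∞) :
    ex p (fun x => f x + g x) = ex p f + ex p g := by
  simp only [ex, mul_add, ENNReal.tsum_add]

theorem ex_mul_const (p : PMF α) (f : α → ℝ≥0∞) (c : ℝ≥0∞) :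
    ex p (fun x => f x * c) = ex p f * c := by
  simp only [ex, ← mul_assoc, ENNReal.tsum_mul_right]

theorem ex_const_mul (p : PMF α) (c : ℝ≥0∞) (f : α → ℝ≥0∞) :
    ex p (fun x => c * f x) = c * ex p f := by
  simp only [mul_comm c, ex_mul_const]

theorem ex_pure (a : α) (f : α → ℝ≥0∞) : ex (PMF.pure a) f = f a := by
  rw [ex, tsum_eq_single a]
  · simp
  · intro b hb
    simp [PMF.pure_apply, hb]

theorem ex_bind (p : PMF α) (q : α → PMF β) (f : β → ℝ≥0∞) :
    ex (p.bind q) f = ex p fun x => ex (q x) f := by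
  simp only [ex, PMF.bind_apply, ← ENNReal.tsum_mul_right, ← ENNReal.tsum_mul_left]
  rw [ENNReal.tsum_comm]
  simp only [mul_assoc]

theorem ex_map (p : PMF α) (g : α → β) (f : β → ℝ≥0∞) :
    ex (p.map g) f = ex p fun x => f (g x) := by
  rw [← PMF.bind_pure_comp, ex_bind]
  simp only [Function.comp, ex_pure]

theorem ex_ofReal [Fintype α] (p : PMF α) {f : α → ℝ} (h : ∀ x, 0 ≤ f x) :
    ex p (fun x => ENNReal.ofReal (f x)) = ENNReal.ofReal (avg p f) := by
  rw [ex, tsum_fintype, avg, ENNReal.ofReal_sum_of_nonneg fun x _ =>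
    mul_nonneg ENNReal.toReal_nonneg (h x)]
  refine Finset.sum_congr rfl fun x _ => ?_
  rw [ENNReal.ofReal_mul ENNReal.toReal_nonneg, ENNReal.ofReal_toReal (p.apply_ne_top x)]

theorem toOuterMeasure_eq_ex (p : PMF α) (s : Set α) :
    p.toOuterMeasure s = ex p (s.indicator fun _ => 1) := by
  rw [PMF.toOuterMeasure_apply, ex]
  refine tsum_congr fun x => ?_
  by_cases hx : x ∈ s <;> simp [hx]

end Expectation

/-! ### Independent samples -/

section Iid

variable {α : Type*} [Fintype α] (p : PMF α)

theorem avg_iid_succ (n : ℕ) (f : (Fin (n + 1) → α) → ℝ) :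
    avg (iid p (n + 1)) f = avg p fun x => avg (iid p n) fun y => f (Fin.cons x y) := by
  rw [iid, avg_bind]
  simp only [avg_map]

theorem avg_iid_prod (n : ℕ) (f : α → ℝ) :
    avg (iid p n) (fun D => ∏ i, f (D i)) = avg p f ^ n := by
  induction n with
  | zero => rw [iid, avg_pure]; simp
  | succ n ih =>
    rw [avg_iid_succ]
    simp only [Fin.prod_univ_succ, Fin.cons_zero, Fin.cons_succ, avg_const_mul, ih, pow_succ]
    simp only [mul_comm _ (avg p f ^ n), avg_const_mul]

theorem toReal_iid_apply (n : ℕ) (D : Fin n → α) :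
    (iid p n D).toReal = ∏ i, (p (D i)).toReal := by
  classical
  -- A point mass is the expectation of a product of indicators, a form on which the recursion
  -- `avg_iid_succ` acts.
  have key : ∀ (q : PMF (Fin n → α)), (q D).toReal =
      avg q fun E => ∏ i, if E i = D i then (1 : ℝ) else 0 := by
    intro q
    rw [avg, Finset.sum_eq_single D]
    · simp
    · intro E _ hE
      obtain ⟨i, hi⟩ := Function.ne_iff.mp hE
      rw [Finset.prod_eq_zero (Finset.mem_univ i) (by simp [hi]), mul_zero]
    · simp
  rw [key]
  clear key
  induction n with
  | zero => rw [iid, avg_pure]; simp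
  | succ n ih =>
    rw [avg_iid_succ]
    simp only [Fin.prod_univ_succ, Fin.cons_zero, Fin.cons_succ, avg_const_mul]
    rw [ih (fun i => D i.succ)]
    simp [avg]

/-- Exchangeability: the mass function is a product of identical factors, which a permutation only
reorders. -/
theorem avg_iid_comp_perm (n : ℕ) (σ : Equiv.Perm (Fin n)) (f : (Fin n → α) → ℝ) :
    avg (iid p n) (fun D => f (D ∘ σ)) = avg (iid p n) f := by
  simp only [avg, toReal_iid_apply]
  refine Fintype.sum_equiv (Equiv.arrowCongr σ.symm (Equiv.refl α)) _ _ fun D => ?_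
  congr 1
  exact (Equiv.prod_comp σ fun i => (p (D i)).toReal).symm

end Iid

/-! ### Occupancy measures -/

section OccupancyFacts

variable {S A : Type*} [Fintype S] [Fintype A]

theorem sum_occupancy_mul (m : MDP S A) (π : Policy S A) (f : S × A → ℝ) :
    ∑ x, occupancy m π x * f x = avg (sampleOccupancy m π) f := by
  simp only [← toReal_sampleOccupancy, avg]

theorem summable_visit (m : MDP S A) (π : Policy S A) (f : S × A → ℝ) :
    Summable fun h : ℕ => m.γ ^ h * avg (visit m π h) f := by
  obtain ⟨B, hB⟩ : ∃ B, ∀ x, |f x| ≤ B :=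
    ⟨∑ x, |f x|, fun x => Finset.single_le_sum (f := fun x => |f x|)
      (fun y _ => abs_nonneg _) (Finset.mem_univ x)⟩
  refine Summable.of_norm_bounded
    ((summable_geometric_of_lt_one m.γ_nonneg m.γ_lt_one).mul_right B) fun h => ?_
  rw [norm_mul, Real.norm_of_nonneg (pow_nonneg m.γ_nonneg h)]
  exact mul_le_mul_of_nonneg_left (abs_avg_le _ hB) (pow_nonneg m.γ_nonneg h)

theorem avg_sampleOccupancy (m : MDP S A) (π : Policy S A) (f : S × A → ℝ) :
    avg (sampleOccupancy m π) f = (1 - m.γ) * ∑' h : ℕ, m.γ ^ h * avg (visit m π h) f := by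
  classical
  have hs : ∀ x, Summable fun h : ℕ => m.γ ^ h * (visit m π h x).toReal := fun x => by
    simpa [avg] using summable_visit m π (fun y => if y = x then 1 else 0)
  rw [← sum_occupancy_mul]
  simp only [occupancy, avg, mul_assoc, ← Finset.mul_sum, ← tsum_mul_right]
  rw [← Summable.tsum_finsetSum fun x _ => (hs x).mul_right (f x) |>.congr fun h => by ring]
  congr 1
  refine tsum_congr fun h => ?_
  rw [Finset.mul_sum]

theorem avg_visit_zero (m : MDP S A) (π : Policy S A) (f : S × A → ℝ) :
    avg (visit m π 0) f = avg m.ν₀ fun s => avg (π s) fun a => f (s, a) := by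
  simp only [visit, avg_bind, avg_map]

theorem avg_visit_succ (m : MDP S A) (π : Policy S A) (h : ℕ) (f : S × A → ℝ) :
    avg (visit m π (h + 1)) f =
      avg (visit m π h) fun x => avg (m.P x.1 x.2) fun s => avg (π s) fun a => f (s, a) := by
  simp only [visit, avg_bind, avg_map]

/-- The Bellman flow equation. -/
theorem avg_sampleOccupancy_flow (m : MDP S A) (π : Policy S A) (f : S × A → ℝ) :
    avg (sampleOccupancy m π) f =
      (1 - m.γ) * (avg m.ν₀ fun s => avg (π s) fun a => f (s, a)) +
      m.γ * avg (sampleOccupancy m π) fun x =>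
        avg (m.P x.1 x.2) fun s => avg (π s) fun a => f (s, a) := by
  rw [avg_sampleOccupancy, (summable_visit m π f).tsum_eq_zero_add, avg_visit_zero,
    avg_sampleOccupancy m π fun x => _]
  simp only [avg_visit_succ, pow_succ', mul_assoc, tsum_mul_left]
  ring

/-- Averaging a function over the actions of the policy does not change its integral. -/
theorem avg_sampleOccupancy_policy (m : MDP S A) (π : Policy S A) (f : S × A → ℝ) :
    avg (sampleOccupancy m π) f =
      avg (sampleOccupancy m π) fun x => avg (π x.1) fun a => f (x.1, a) := by
  have h := avg_sampleOccupancy_flow m π fun x => avg (π x.1) fun a => f (x.1, a)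
  simp only [avg_const] at h
  rw [h, ← avg_sampleOccupancy_flow]

/-- For functions of the state alone the initial term no longer involves the policy, so it cancels
when two policies are compared. -/
theorem avg_sampleOccupancy_state (m : MDP S A) (π : Policy S A) (V : S → ℝ) :
    avg (sampleOccupancy m π) (fun x => V x.1) =
      (1 - m.γ) * avg m.ν₀ V +
      m.γ * avg (sampleOccupancy m π) fun x => avg (m.P x.1 x.2) V := by
  rw [avg_sampleOccupancy_flow]
  simp only [avg_const]

/-- If two policies are `κ`-close on every bounded function of the actions, their occupancy
measures are `κ / (1 - γ)`-close on bounded functions. -/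
theorem avg_sampleOccupancy_sub_le (m : MDP S A) (π π' : Policy S A) {κ B : ℝ} (hB : 0 ≤ B)
    (hκ : 0 ≤ κ)
    (hπ : ∀ s, ∀ f : A → ℝ, (∀ a, |f a| ≤ B) → |avg (π s) f - avg (π' s) f| ≤ B * κ)
    (f : S × A → ℝ) (hf : ∀ x, |f x| ≤ B) :
    |avg (sampleOccupancy m π) f - avg (sampleOccupancy m π') f| ≤ B * κ / (1 - m.γ) := by
  have hγ := m.γ_lt_one
  -- Each use of the flow equation costs a one-step error `Bκ` and discounts the trivial bound `2B`
  -- by `γ`. The function must be general, since the recursion passes to its one-step conditional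
  -- expectation.
  have hstep : ∀ n : ℕ, ∀ f : S × A → ℝ, (∀ x, |f x| ≤ B) →
      |avg (sampleOccupancy m π) f - avg (sampleOccupancy m π') f| ≤
        B * κ / (1 - m.γ) + m.γ ^ n * (2 * B) := by
    intro n
    induction n with
    | zero =>
      intro f hf
      have h1 := abs_avg_le (sampleOccupancy m π) hf
      have h2 := abs_avg_le (sampleOccupancy m π') hf
      have h3 := abs_sub (avg (sampleOccupancy m π) f) (avg (sampleOccupancy m π') f)
      have h4 : 0 ≤ B * κ / (1 - m.γ) := div_nonneg (mul_nonneg hB hκ) (by linarith)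
      rw [pow_zero]
      linarith
    | succ n ih =>
      intro f hf
      set g : S → ℝ := fun s => avg (π s) fun a => f (s, a)
      set g' : S → ℝ := fun s => avg (π' s) fun a => f (s, a)
      have hg : ∀ s, |g s| ≤ B := fun s => abs_avg_le _ fun a => hf (s, a)
      have hgg : ∀ s, |g s - g' s| ≤ B * κ := fun s => hπ s _ fun a => hf (s, a)
      have e1 := avg_sampleOccupancy_flow m π f
      have e2 := avg_sampleOccupancy_flow m π' f
      have h1 : |avg m.ν₀ g - avg m.ν₀ g'| ≤ B * κ := abs_avg_sub_avg_le _ hgg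
      have h2 := ih (fun x => avg (m.P x.1 x.2) g) fun x => abs_avg_le _ hg
      have h3 : |avg (sampleOccupancy m π') (fun x => avg (m.P x.1 x.2) g) -
          avg (sampleOccupancy m π') fun x => avg (m.P x.1 x.2) g'| ≤ B * κ :=
        abs_avg_sub_avg_le _ fun x => abs_avg_sub_avg_le _ hgg
      have h4 : |avg (sampleOccupancy m π) (fun x => avg (m.P x.1 x.2) g) -
          avg (sampleOccupancy m π') fun x => avg (m.P x.1 x.2) g'| ≤
          B * κ / (1 - m.γ) + m.γ ^ n * (2 * B) + B * κ :=
        (abs_sub_le _ _ _).trans (add_le_add h2 h3)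
      have h5 : avg (sampleOccupancy m π) f - avg (sampleOccupancy m π') f =
          (1 - m.γ) * (avg m.ν₀ g - avg m.ν₀ g') +
          m.γ * (avg (sampleOccupancy m π) (fun x => avg (m.P x.1 x.2) g) -
            avg (sampleOccupancy m π') fun x => avg (m.P x.1 x.2) g') := by
        rw [e1, e2]
        ring
      rw [h5]
      refine (abs_add_le _ _).trans ?_
      rw [abs_mul, abs_mul, abs_of_nonneg m.γ_nonneg, abs_of_pos (by linarith : 0 < 1 - m.γ)]
      have h6 := mul_le_mul_of_nonneg_left h1 (by linarith : 0 ≤ 1 - m.γ)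
      have h7 := mul_le_mul_of_nonneg_left h4 m.γ_nonneg
      have h8 : (1 - m.γ) * (B * κ) + m.γ * (B * κ / (1 - m.γ) + m.γ ^ n * (2 * B) + B * κ) =
          B * κ / (1 - m.γ) + m.γ ^ (n + 1) * (2 * B) := by
        have : 1 - m.γ ≠ 0 := by linarith
        field_simp
        ring
      linarith
  have hlim : Filter.Tendsto (fun n : ℕ => B * κ / (1 - m.γ) + m.γ ^ n * (2 * B)) Filter.atTop
      (nhds (B * κ / (1 - m.γ) + 0 * (2 * B))) :=
    ((tendsto_pow_atTop_nhds_zero_of_lt_one m.γ_nonneg hγ).mul_const _).const_add _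
  rw [zero_mul, add_zero] at hlim
  exact ge_of_tendsto' hlim fun n => hstep n f hf

end OccupancyFacts

/-! ### Softmax policies -/

section Softmax

variable {S A : Type*} [Fintype A]

/-- The free energy `η⁻¹ log ∑ₐ exp(-η f(s, a))`. -/
def freeEnergy (η : ℝ) (f : S × A → ℝ) (s : S) : ℝ :=
  η⁻¹ * Real.log (∑ a, Real.exp (-η * f (s, a)))

theorem freeEnergy_zero (η : ℝ) (s : S) :
    freeEnergy η (0 : S × A → ℝ) s = Real.log (Fintype.card A) / η := by
  simp [freeEnergy, div_eq_inv_mul]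

theorem neg_le_freeEnergy {η : ℝ} (hη : 0 < η) (f : S × A → ℝ) (s : S) (a : A) :
    -f (s, a) ≤ freeEnergy η f s := by
  have h1 : Real.exp (-η * f (s, a)) ≤ ∑ a', Real.exp (-η * f (s, a')) :=
    Finset.single_le_sum (f := fun a' => Real.exp (-η * f (s, a')))
      (fun _ _ => (Real.exp_pos _).le) (Finset.mem_univ a)
  have h2 := Real.log_le_log (Real.exp_pos _) h1
  rw [Real.log_exp] at h2
  have h3 := mul_le_mul_of_nonneg_left h2 (inv_pos.mpr hη).le
  rw [freeEnergy]
  calc -f (s, a) = η⁻¹ * (-η * f (s, a)) := by field_simp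
    _ ≤ _ := h3

variable [Nonempty A]

theorem sum_exp_pos (g : A → ℝ) : 0 < ∑ a, Real.exp (g a) :=
  Finset.sum_pos (fun _ _ => Real.exp_pos _) Finset.univ_nonempty

theorem toReal_softmaxPolicy (η : ℝ) (f : S × A → ℝ) (s : S) (a : A) :
    (softmaxPolicy η f s a).toReal =
      Real.exp (-η * f (s, a)) / ∑ a', Real.exp (-η * f (s, a')) := by
  rw [softmaxPolicy, PMF.normalize_apply, tsum_fintype, ENNReal.toReal_mul,
    ENNReal.toReal_ofReal (Real.exp_pos _).le, ENNReal.toReal_inv,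
    ENNReal.toReal_sum fun _ _ => ENNReal.ofReal_ne_top, div_eq_mul_inv]
  simp only [ENNReal.toReal_ofReal (Real.exp_pos _).le]

/-- One step of exponential weights. -/
theorem avg_softmaxPolicy_le {η B : ℝ} (hη : 0 < η) (f q : S × A → ℝ) (hq : ∀ x, |q x| ≤ B)
    (s : S) :
    avg (softmaxPolicy η f s) (fun a => q (s, a)) ≤
      freeEnergy η f s - freeEnergy η (fun x => f x + q x) s + η * B ^ 2 / 2 := by
  have h1 := avg_exp_mul_le (softmaxPolicy η f s) (fun a => hq (s, a)) (-η)
  have h2 : avg (softmaxPolicy η f s) (fun a => Real.exp (-η * q (s, a))) =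
      (∑ a, Real.exp (-η * (f (s, a) + q (s, a)))) / ∑ a, Real.exp (-η * f (s, a)) := by
    rw [avg, Finset.sum_div]
    refine Finset.sum_congr rfl fun a _ => ?_
    rw [toReal_softmaxPolicy, mul_add, Real.exp_add]
    ring
  rw [h2] at h1
  have h3 := Real.log_le_log (div_pos (sum_exp_pos _) (sum_exp_pos _)) h1
  rw [Real.log_exp, Real.log_div (sum_exp_pos _).ne' (sum_exp_pos _).ne'] at h3
  have h4 := mul_le_mul_of_nonneg_left h3 (inv_pos.mpr hη).le
  rw [mul_sub] at h4
  have h5 : η⁻¹ * (-η * (avg (softmaxPolicy η f s) fun x => q (s, x)) + B ^ 2 * (-η) ^ 2 / 2) =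
      -(avg (softmaxPolicy η f s) fun x => q (s, x)) + η * B ^ 2 / 2 := by
    field_simp
  rw [h5] at h4
  simp only [freeEnergy]
  linarith

/-- Softmax policies are stable under bounded perturbations. -/
theorem abs_avg_softmaxPolicy_sub_le {η B C : ℝ} (hη : 0 < η) (f q : S × A → ℝ)
    (hq : ∀ x, |q x| ≤ B) (s : S) (g : A → ℝ) (hg : ∀ a, |g a| ≤ C) :
    |avg (softmaxPolicy η f s) g - avg (softmaxPolicy η (fun x => f x + q x) s) g| ≤
      C * (4 * η * B) := by
  set p := softmaxPolicy η f s
  set p' := softmaxPolicy η (fun x => f x + q x) s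
  have hC : 0 ≤ C := (abs_nonneg _).trans (hg (Classical.arbitrary A))
  -- Numerator and normalizer each change by a factor at most `exp(ηB)`, whence `p' ≥ exp(-2ηB) p`.
  have hlow : ∀ a, (p a).toReal - 2 * η * B * (p a).toReal ≤ (p' a).toReal := by
    intro a
    have hqa := fun a => abs_le.mp (hq (s, a))
    have hZ : ∑ a, Real.exp (-η * (f (s, a) + q (s, a))) ≤
        Real.exp (η * B) * ∑ a, Real.exp (-η * f (s, a)) := by
      rw [Finset.mul_sum]
      refine Finset.sum_le_sum fun a _ => ?_
      rw [← Real.exp_add, Real.exp_le_exp]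
      nlinarith [hqa a]
    have hN : Real.exp (-(η * B)) * Real.exp (-η * f (s, a)) ≤
        Real.exp (-η * (f (s, a) + q (s, a))) := by
      rw [← Real.exp_add, Real.exp_le_exp]
      nlinarith [hqa a]
    have h1 : (1 - 2 * η * B) * (p a).toReal ≤ Real.exp (-(2 * η * B)) * (p a).toReal :=
      mul_le_mul_of_nonneg_right (by linarith [Real.add_one_le_exp (-(2 * η * B))])
        ENNReal.toReal_nonneg
    have h2 : Real.exp (-(2 * η * B)) * (p a).toReal ≤ (p' a).toReal := by
      simp only [p, p', toReal_softmaxPolicy]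
      rw [mul_div_assoc', div_le_div_iff₀ (sum_exp_pos _) (sum_exp_pos _)]
      calc Real.exp (-(2 * η * B)) * Real.exp (-η * f (s, a)) *
            ∑ a, Real.exp (-η * (f (s, a) + q (s, a)))
          ≤ Real.exp (-(2 * η * B)) * Real.exp (-η * f (s, a)) *
            (Real.exp (η * B) * ∑ a, Real.exp (-η * f (s, a))) :=
            mul_le_mul_of_nonneg_left hZ (by positivity)
        _ = Real.exp (-(η * B)) * Real.exp (-η * f (s, a)) *
            ∑ a, Real.exp (-η * f (s, a)) := by
            have : Real.exp (-(η * B)) = Real.exp (-(2 * η * B)) * Real.exp (η * B) := by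
              rw [← Real.exp_add]
              congr 1
              ring
            rw [this]
            ring
        _ ≤ _ := mul_le_mul_of_nonneg_right hN (sum_exp_pos _).le
    linarith
  have hB : 0 ≤ B := (abs_nonneg _).trans (hq (s, Classical.arbitrary A))
  -- A one-sided bound suffices: `|x| = 2x⁺ - x`, and the differences `p - p'` sum to zero. This
  -- doubling turns `2ηB` into `4ηB`.
  have habs : ∀ a, |(p a).toReal - (p' a).toReal| ≤
      2 * (2 * η * B * (p a).toReal) - ((p a).toReal - (p' a).toReal) := by
    intro a
    have h0 : 0 ≤ 2 * η * B * (p a).toReal := mul_nonneg (by positivity) ENNReal.toReal_nonneg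
    rw [abs_le]
    constructor <;> linarith [hlow a]
  rw [avg, avg, ← Finset.sum_sub_distrib]
  calc |∑ a, ((p a).toReal * g a - (p' a).toReal * g a)|
      ≤ ∑ a, |(p a).toReal * g a - (p' a).toReal * g a| := Finset.abs_sum_le_sum_abs _ _
    _ ≤ ∑ a, C * (2 * (2 * η * B * (p a).toReal) - ((p a).toReal - (p' a).toReal)) := by
        refine Finset.sum_le_sum fun a _ => ?_
        rw [← sub_mul, abs_mul, mul_comm]
        exact mul_le_mul (hg a) (habs a) (abs_nonneg _) hC
    _ = C * (4 * η * B) := by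
        simp only [← Finset.mul_sum, Finset.sum_sub_distrib, sum_toReal_eq_one]
        ring

end Softmax

/-! ### The regularized covariance matrix -/

section Covariance

open Matrix

variable {S A : Type*} {d τ : ℕ} (Φ : Features S A d) (D : Batch S A τ)

/-- The features of the `i`-th transition of a dataset. -/
def feat (i : Fin τ) : Fin d → ℝ := Φ ((D i).1, (D i).2.1)

theorem covariance_mulVec (u : Fin d → ℝ) :
    covariance Φ D *ᵥ u = u + ∑ i, (feat Φ D i ⬝ᵥ u) • feat Φ D i := by
  rw [covariance, add_mulVec, one_mulVec, sum_mulVec, add_comm]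
  congr 1
  refine Finset.sum_congr rfl fun i _ => ?_
  rw [vecMulVec_mulVec]
  ext j
  simp [feat, mul_comm]

theorem covariance_mulVec_dotProduct (u v : Fin d → ℝ) :
    covariance Φ D *ᵥ u ⬝ᵥ v = u ⬝ᵥ v + ∑ i, (feat Φ D i ⬝ᵥ u) * (feat Φ D i ⬝ᵥ v) := by
  rw [covariance_mulVec, add_dotProduct, sum_dotProduct]
  simp only [smul_dotProduct, smul_eq_mul]

theorem dotProduct_self_nonneg' (u : Fin d → ℝ) : 0 ≤ u ⬝ᵥ u :=
  Finset.sum_nonneg fun _ _ => mul_self_nonneg _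

/-- The quadratic form of `Λ` is at least `|u|²`, so the kernel is trivial. -/
theorem isUnit_det_covariance : IsUnit (covariance Φ D).det := by
  rw [← Matrix.isUnit_iff_isUnit_det, ← Matrix.mulVec_injective_iff_isUnit]
  refine (injective_iff_map_eq_zero (covariance Φ D).mulVecLin).mpr fun u hu => ?_
  have h := covariance_mulVec_dotProduct Φ D u u
  rw [← mulVecLin_apply, hu, zero_dotProduct] at h
  have h1 : 0 ≤ ∑ i, (feat Φ D i ⬝ᵥ u) * (feat Φ D i ⬝ᵥ u) :=
    Finset.sum_nonneg fun _ _ => mul_self_nonneg _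
  exact dotProduct_self_eq_zero.mp (le_antisymm (by linarith) (dotProduct_self_nonneg' u))

theorem covariance_mulVec_inv (y : Fin d → ℝ) :
    covariance Φ D *ᵥ ((covariance Φ D)⁻¹ *ᵥ y) = y := by
  rw [mulVec_mulVec, mul_nonsing_inv _ (isUnit_det_covariance Φ D), one_mulVec]

theorem dotProduct_inv_covariance_eq (y v : Fin d → ℝ) :
    y ⬝ᵥ v = ((covariance Φ D)⁻¹ *ᵥ y) ⬝ᵥ v +
      ∑ i, (feat Φ D i ⬝ᵥ ((covariance Φ D)⁻¹ *ᵥ y)) * (feat Φ D i ⬝ᵥ v) := by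
  rw [← covariance_mulVec_dotProduct, covariance_mulVec_inv]

theorem dotProduct_inv_covariance_comm (y z : Fin d → ℝ) :
    y ⬝ᵥ ((covariance Φ D)⁻¹ *ᵥ z) = ((covariance Φ D)⁻¹ *ᵥ y) ⬝ᵥ z := by
  rw [dotProduct_inv_covariance_eq Φ D y, dotProduct_comm _ z,
    dotProduct_inv_covariance_eq Φ D z, dotProduct_comm ((covariance Φ D)⁻¹ *ᵥ z)]
  simp only [mul_comm]

/-- The squared norm `‖y‖²` with respect to `Λ⁻¹`. -/
def invSq (y : Fin d → ℝ) : ℝ := y ⬝ᵥ (covariance Φ D)⁻¹ *ᵥ y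

/-- With `u = Λ⁻¹y`, the squared `Λ⁻¹`-norm of `y` is the squared `Λ`-norm of `u`. This explicit sum
of squares replaces matrix square roots below. -/
theorem invSq_eq (y : Fin d → ℝ) :
    invSq Φ D y = ((covariance Φ D)⁻¹ *ᵥ y) ⬝ᵥ ((covariance Φ D)⁻¹ *ᵥ y) +
      ∑ i, (feat Φ D i ⬝ᵥ ((covariance Φ D)⁻¹ *ᵥ y)) ^ 2 := by
  simp only [sq]
  rw [← dotProduct_inv_covariance_eq, invSq]

theorem inv_dotProduct_self_le_invSq (y : Fin d → ℝ) :
    ((covariance Φ D)⁻¹ *ᵥ y) ⬝ᵥ ((covariance Φ D)⁻¹ *ᵥ y) ≤ invSq Φ D y := by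
  rw [invSq_eq]
  exact le_add_of_nonneg_right (Finset.sum_nonneg fun _ _ => sq_nonneg _)

theorem invSq_nonneg (y : Fin d → ℝ) : 0 ≤ invSq Φ D y :=
  (dotProduct_self_nonneg' _).trans (inv_dotProduct_self_le_invSq Φ D y)

theorem abs_dotProduct_le_sqrt (x y : Fin d → ℝ) : |x ⬝ᵥ y| ≤ √(x ⬝ᵥ x) * √(y ⬝ᵥ y) := by
  rw [← Real.sqrt_mul (dotProduct_self_nonneg' x)]
  refine Real.abs_le_sqrt ?_
  have := Finset.sum_mul_sq_le_sq_mul_sq Finset.univ x y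
  simpa only [dotProduct, sq] using this

/-- By Cauchy–Schwarz `‖y‖²_{Λ⁻¹} = ⟨y, Λ⁻¹y⟩ ≤ |y| |Λ⁻¹y| ≤ |y| ‖y‖_{Λ⁻¹}`; one factor is
cancelled. -/
theorem invSq_le (y : Fin d → ℝ) : invSq Φ D y ≤ y ⬝ᵥ y := by
  have h1 := inv_dotProduct_self_le_invSq Φ D y
  have h2 := (le_abs_self _).trans (abs_dotProduct_le_sqrt y ((covariance Φ D)⁻¹ *ᵥ y))
  change invSq Φ D y ≤ _ at h2
  have h3 := Real.sqrt_le_sqrt h1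
  have h4 := Real.mul_self_sqrt (invSq_nonneg Φ D y)
  have h5 := Real.mul_self_sqrt (dotProduct_self_nonneg' y)
  have h6 := Real.sqrt_nonneg (y ⬝ᵥ y)
  have h7 := Real.sqrt_nonneg (invSq Φ D y)
  have h8 := h2.trans (mul_le_mul_of_nonneg_left h3 h6)
  have h9 : √(invSq Φ D y) ≤ √(y ⬝ᵥ y) := by
    by_contra hc
    push Not at hc
    nlinarith [mul_pos (lt_of_le_of_lt h6 hc) (sub_pos.mpr hc)]
  calc invSq Φ D y = √(invSq Φ D y) * √(invSq Φ D y) := h4.symm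
    _ ≤ √(y ⬝ᵥ y) * √(y ⬝ᵥ y) := mul_self_le_mul_self h7 h9
    _ = _ := h5

theorem abs_le_one_of_dotProduct_self_le_one {u : Fin d → ℝ} (h : u ⬝ᵥ u ≤ 1) (i : Fin d) :
    |u i| ≤ 1 := by
  rw [abs_le_one_iff_mul_self_le_one]
  exact (Finset.single_le_sum (f := fun i => u i * u i) (fun i _ => mul_self_nonneg _)
    (Finset.mem_univ i)).trans h

/-- A column `Λ⁻¹eⱼ` has Euclidean norm at most `‖eⱼ‖_{Λ⁻¹} ≤ 1`. This confines the matrix parameter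
of a value function to a box. -/
theorem abs_inv_covariance_apply_le (i j : Fin d) : |(covariance Φ D)⁻¹ i j| ≤ 1 := by
  have h : ((covariance Φ D)⁻¹ *ᵥ Pi.single j 1) i = (covariance Φ D)⁻¹ i j := by simp
  rw [← h]
  refine abs_le_one_of_dotProduct_self_le_one ?_ i
  refine (inv_dotProduct_self_le_invSq Φ D _).trans ((invSq_le Φ D _).trans ?_)
  simp

/-- The sum is `tr(Λ⁻¹(Λ - I)) = d - tr Λ⁻¹`, and `Λ⁻¹` has a nonnegative diagonal. -/
theorem sum_invSq_feat_le : ∑ i, invSq Φ D (feat Φ D i) ≤ d := by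
  have h1 : ∑ i, invSq Φ D (feat Φ D i) =
      trace ((covariance Φ D)⁻¹ * ∑ i, vecMulVec (feat Φ D i) (feat Φ D i)) := by
    rw [Matrix.mul_sum, trace_sum]
    refine Finset.sum_congr rfl fun i _ => ?_
    rw [mul_vecMulVec, trace_vecMulVec, invSq, dotProduct_comm]
  have h2 : ∑ i, vecMulVec (feat Φ D i) (feat Φ D i) = covariance Φ D - 1 :=
    (add_sub_cancel_right _ _).symm
  rw [h1, h2, Matrix.mul_sub, nonsing_inv_mul _ (isUnit_det_covariance Φ D), Matrix.mul_one,
    trace_sub, trace_one, Fintype.card_fin]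
  refine sub_le_self _ (Finset.sum_nonneg fun j _ => ?_)
  have h := invSq_nonneg Φ D (Pi.single j 1)
  simpa [invSq] using h

theorem covariance_cons (x : S × A × S) :
    covariance Φ (Fin.cons x D : Batch S A (τ + 1)) =
      covariance Φ D + vecMulVec (Φ (x.1, x.2.1)) (Φ (x.1, x.2.1)) := by
  simp only [covariance, Fin.sum_univ_succ, Fin.cons_zero, Fin.cons_succ]
  abel

/-- Adding a vector of norm at most one to the dataset at most halves its squared norm with
respect to `Λ⁻¹`. -/
theorem invSq_le_two_mul_invSq_cons (x : S × A × S)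
    (hx : Φ (x.1, x.2.1) ⬝ᵥ Φ (x.1, x.2.1) ≤ 1) :
    invSq Φ D (Φ (x.1, x.2.1)) ≤
      2 * invSq Φ (Fin.cons x D : Batch S A (τ + 1)) (Φ (x.1, x.2.1)) := by
  set y := Φ (x.1, x.2.1)
  set a := invSq Φ D y with ha
  have ha0 : 0 ≤ a := invSq_nonneg Φ D y
  have ha1 : a ≤ 1 := (invSq_le Φ D y).trans hx
  set E : Batch S A (τ + 1) := Fin.cons x D
  -- The Sherman–Morrison computation: `(Λ + yyᵀ)Λ⁻¹y = (1 + a)y`. Hence the old and new squared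
  -- norms satisfy `a = (1 + a)a'`, and `a ≤ 1` gives the factor two.
  have h1 : covariance Φ E *ᵥ ((covariance Φ D)⁻¹ *ᵥ y) = (1 + a) • y := by
    rw [covariance_cons, add_mulVec, covariance_mulVec_inv, vecMulVec_mulVec, add_smul, one_smul]
    congr 1
    ext j
    simp [ha, invSq, mul_comm, y]
  have h2 : (covariance Φ D)⁻¹ *ᵥ y = (1 + a) • (covariance Φ E)⁻¹ *ᵥ y := by
    rw [← mulVec_smul, ← h1, mulVec_mulVec, nonsing_inv_mul _ (isUnit_det_covariance Φ E),
      one_mulVec]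
  have h3 : a = (1 + a) * invSq Φ E y := by
    conv_lhs => rw [ha, invSq, h2, dotProduct_smul, smul_eq_mul]
    rfl
  nlinarith [invSq_nonneg Φ E y]

theorem bonus_eq (β : ℝ) (x : S × A) : bonus Φ β D x = β * √(invSq Φ D (Φ x)) := rfl

/-- Moving the symmetric `Λ⁻¹` onto the test vector exhibits the prediction as a weighted sum of the
observed values. -/
theorem dotProduct_regress (V : S → ℝ) (y : Fin d → ℝ) :
    y ⬝ᵥ regress Φ D V =
      ∑ i, (feat Φ D i ⬝ᵥ ((covariance Φ D)⁻¹ *ᵥ y)) * V (D i).2.2 := by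
  rw [regress, dotProduct_inv_covariance_comm, dotProduct_sum]
  refine Finset.sum_congr rfl fun i _ => ?_
  rw [dotProduct_smul, smul_eq_mul, mul_comm, dotProduct_comm]
  rfl

/-- Crude but sufficient: the bound only sets the size of a grid, which enters through its
logarithm. -/
theorem abs_regress_le (hΦ : ∀ x, ∑ i, |Φ x i| ≤ 1) {V : S → ℝ} {B : ℝ} (hV : ∀ s, |V s| ≤ B)
    (i : Fin d) : |regress Φ D V i| ≤ τ * B := by
  have h1 : ∀ j, |(∑ k, V (D k).2.2 • Φ ((D k).1, (D k).2.1)) j| ≤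
      ∑ k, B * |Φ ((D k).1, (D k).2.1) j| := fun j => by
    rw [Finset.sum_apply]
    refine (Finset.abs_sum_le_sum_abs _ _).trans (Finset.sum_le_sum fun k _ => ?_)
    rw [Pi.smul_apply, smul_eq_mul, abs_mul]
    exact mul_le_mul_of_nonneg_right (hV _) (abs_nonneg _)
  calc |regress Φ D V i|
      ≤ ∑ j, |(covariance Φ D)⁻¹ i j| * |(∑ k, V (D k).2.2 • Φ ((D k).1, (D k).2.1)) j| := by
        rw [regress, mulVec, dotProduct]
        refine (Finset.abs_sum_le_sum_abs _ _).trans_eq ?_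
        simp only [abs_mul]
    _ ≤ ∑ j, 1 * ∑ k, B * |Φ ((D k).1, (D k).2.1) j| :=
        Finset.sum_le_sum fun j _ => mul_le_mul (abs_inv_covariance_apply_le Φ D i j) (h1 j)
          (abs_nonneg _) zero_le_one
    _ = ∑ k, B * ∑ j, |Φ ((D k).1, (D k).2.1) j| := by
        simp only [one_mul, Finset.mul_sum]
        exact Finset.sum_comm
    _ ≤ ∑ _k : Fin τ, B * 1 := Finset.sum_le_sum fun k _ =>
        mul_le_mul_of_nonneg_left (hΦ _) ((abs_nonneg _).trans (hV (D k).1))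
    _ = τ * B := by simp

theorem dotProduct_self_le_one_of_sum_abs {y : Fin d → ℝ} (h : ∑ i, |y i| ≤ 1) :
    y ⬝ᵥ y ≤ 1 := by
  have h0 : 0 ≤ ∑ i, |y i| := Finset.sum_nonneg fun _ _ => abs_nonneg _
  calc y ⬝ᵥ y ≤ ∑ i, |y i| * ∑ j, |y j| := Finset.sum_le_sum fun i _ => by
        rw [← abs_mul_abs_self]
        exact mul_le_mul_of_nonneg_left (Finset.single_le_sum (f := fun j => |y j|)
          (fun j _ => abs_nonneg _) (Finset.mem_univ i)) (abs_nonneg _)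
    _ = (∑ i, |y i|) * ∑ j, |y j| := by rw [Finset.sum_mul]
    _ ≤ 1 := by nlinarith

theorem abs_dotProduct_le_of_sum_abs {y v : Fin d → ℝ} {c : ℝ} (hc : 0 ≤ c)
    (h : ∑ i, |y i| ≤ 1) (hv : ∀ i, |v i| ≤ c) : |y ⬝ᵥ v| ≤ c :=
  calc |y ⬝ᵥ v| ≤ ∑ i, |y i| * |v i| := by
        refine (Finset.abs_sum_le_sum_abs _ _).trans_eq ?_
        simp only [abs_mul]
    _ ≤ ∑ i, |y i| * c :=
        Finset.sum_le_sum fun i _ => mul_le_mul_of_nonneg_left (hv i) (abs_nonneg _)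
    _ = (∑ i, |y i|) * c := by rw [Finset.sum_mul]
    _ ≤ 1 * c := mul_le_mul_of_nonneg_right h hc
    _ = c := one_mul c

end Covariance

/-! ### The expected size of the bonus -/

section BonusSize

open Matrix

variable {S A : Type*} [Fintype S] [Fintype A] {d : ℕ} (m : MDP S A) (Φ : Features S A d)

theorem avg_sampleTransition (π : Policy S A) (f : S × A × S → ℝ) :
    avg (sampleTransition m π) f =
      avg (sampleOccupancy m π) fun x => avg (m.P x.1 x.2) fun s => f (x.1, x.2, s) := by
  simp only [sampleTransition, avg_bind, avg_map]

/-- The point `x` is regarded as one more sample. Including it in the covariance costs a factor two;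
afterwards all `τ + 1` samples play the same role, and their squared norms sum to at most `d`. -/
theorem avg_iid_invSq_le (hΦ : ∀ x, ∑ i, |Φ x i| ≤ 1) (π : Policy S A) (τ : ℕ) :
    avg (iid (sampleTransition m π) τ) (fun D => avg (sampleOccupancy m π) fun x =>
      invSq Φ D (Φ x)) ≤ 2 * d / (τ + 1) := by
  set p := sampleTransition m π with hp
  -- The fresh state-action pair is completed to a full transition, whose next state is ignored.
  have hswap : ∀ f : Batch S A τ → S × A → ℝ,
      avg (iid p τ) (fun D => avg (sampleOccupancy m π) fun x => f D x) =
        avg p fun x => avg (iid p τ) fun D => f D (x.1, x.2.1) := by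
    intro f
    rw [hp, avg_sampleTransition]
    simp only [avg_const]
    rw [← hp]
    simp only [avg, Finset.mul_sum]
    rw [Finset.sum_comm]
    exact Finset.sum_congr rfl fun x _ => Finset.sum_congr rfl fun D _ => by ring
  rw [hswap]
  have h1 : (avg p fun x => avg (iid p τ) fun D => invSq Φ D (Φ (x.1, x.2.1))) ≤
      2 * avg (iid p (τ + 1)) fun E => invSq Φ E (feat Φ E 0) := by
    rw [avg_iid_succ, ← avg_const_mul]
    refine avg_mono _ fun x => ?_
    rw [← avg_const_mul]
    exact avg_mono _ fun D => invSq_le_two_mul_invSq_cons Φ D x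
      (dotProduct_self_le_one_of_sum_abs (hΦ _))
  have h2 : ∀ i : Fin (τ + 1), (avg (iid p (τ + 1)) fun E => invSq Φ E (feat Φ E i)) =
      avg (iid p (τ + 1)) fun E => invSq Φ E (feat Φ E 0) := by
    intro i
    rw [← avg_iid_comp_perm p (τ + 1) (Equiv.swap 0 i)]
    refine congrArg _ (funext fun E => ?_)
    have hc : covariance Φ (E ∘ Equiv.swap 0 i) = covariance Φ E := by
      rw [covariance, covariance]
      congr 1
      exact Equiv.sum_comp (Equiv.swap 0 i)
        fun k => vecMulVec (Φ ((E k).1, (E k).2.1)) (Φ ((E k).1, (E k).2.1))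
    simp [invSq, hc, feat]
  have h3 : ∑ i : Fin (τ + 1), (avg (iid p (τ + 1)) fun E => invSq Φ E (feat Φ E i)) ≤ d := by
    rw [← avg_sum, ← avg_const (iid p (τ + 1)) (d : ℝ)]
    exact avg_mono _ fun E => sum_invSq_feat_le Φ E
  simp only [h2, Finset.sum_const, Finset.card_univ, Fintype.card_fin, nsmul_eq_mul] at h3
  push_cast at h3
  rw [le_div_iff₀ (by positivity)]
  have h4 : (0 : ℝ) ≤ τ := Nat.cast_nonneg τ
  nlinarith

/-- Jensen's inequality in the form `√y ≤ r/2 + y/(2r)`, with `r` the target value so that both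
halves contribute `r/2`. -/
theorem avg_iid_sqrt_invSq_le (hd : 0 < d) (hΦ : ∀ x, ∑ i, |Φ x i| ≤ 1) (π : Policy S A) {τ : ℕ}
    (hτ : 0 < τ) :
    avg (iid (sampleTransition m π) τ) (fun D => avg (sampleOccupancy m π) fun x =>
      √(invSq Φ D (Φ x))) ≤ √(2 * d / τ) := by
  have hτ' : (0 : ℝ) < τ := Nat.cast_pos.mpr hτ
  have hd' : (0 : ℝ) < d := Nat.cast_pos.mpr hd
  set r := √(2 * d / τ) with hr
  have hr0 : 0 < r := Real.sqrt_pos.mpr (by positivity)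
  have hr2 : r ^ 2 = 2 * d / τ := Real.sq_sqrt (by positivity)
  have h1 : ∀ D : Batch S A τ, ∀ x, √(invSq Φ D (Φ x)) ≤
      r / 2 + (2 * r)⁻¹ * invSq Φ D (Φ x) := by
    intro D x
    have h2 := Real.sq_sqrt (invSq_nonneg Φ D (Φ x))
    set y := √(invSq Φ D (Φ x))
    rw [← h2]
    have h3 : r / 2 + (2 * r)⁻¹ * y ^ 2 - y = (2 * r)⁻¹ * (y - r) ^ 2 := by
      field_simp
      ring
    have h4 : 0 ≤ (2 * r)⁻¹ * (y - r) ^ 2 := by positivity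
    linarith
  calc _ ≤ avg (iid (sampleTransition m π) τ) (fun D => avg (sampleOccupancy m π) fun x =>
        (r / 2 + (2 * r)⁻¹ * invSq Φ D (Φ x))) :=
        avg_mono _ fun D => avg_mono _ fun x => h1 D x
    _ = r / 2 + (2 * r)⁻¹ * avg (iid (sampleTransition m π) τ) (fun D =>
        avg (sampleOccupancy m π) fun x => invSq Φ D (Φ x)) := by
        simp only [avg_add, avg_const, avg_const_mul]
    _ ≤ r / 2 + (2 * r)⁻¹ * r ^ 2 := by
        rw [hr2]
        refine add_le_add le_rfl (mul_le_mul_of_nonneg_left ?_ (by positivity))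
        refine (avg_iid_invSq_le m Φ hΦ π τ).trans ?_
        exact div_le_div_of_nonneg_left (by positivity) hτ' (by linarith)
    _ = r := by
        field_simp
        ring

end BonusSize

/-! ### Regression error -/

section Regression

open Matrix

variable {S A : Type*} [Fintype S] {d τ : ℕ} (m : MDP S A) (Φ : Features S A d)

/-- The deviation `∑ᵢ ⟨φᵢ, w⟩ (V(s'ᵢ) - P V(sᵢ, aᵢ))`. -/
def noise (D : Batch S A τ) (V : S → ℝ) (w : Fin d → ℝ) : ℝ :=
  ∑ i, (feat Φ D i ⬝ᵥ w) * (V (D i).2.2 - avg (m.P (D i).1 (D i).2.1) V)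

theorem noise_smul (D : Batch S A τ) (V : S → ℝ) (c : ℝ) (w : Fin d → ℝ) :
    noise m Φ D V (c • w) = c * noise m Φ D V w := by
  simp only [noise, dotProduct_smul, smul_eq_mul, Finset.mul_sum, mul_assoc]

/-- Since `P = ΦM`, the vector is `z = MV`; the `ℓ¹` bound on the rows of `M` bounds its entries. -/
theorem exists_avg_eq_dotProduct {m : MDP S A} {Φ : Features S A d} (hlin : IsLinear m Φ)
    {V : S → ℝ} {B : ℝ} (hB : 0 ≤ B) (hV : ∀ s, |V s| ≤ B) :
    ∃ z : Fin d → ℝ, (∀ i, |z i| ≤ B) ∧ ∀ x, avg (m.P x.1 x.2) V = Φ x ⬝ᵥ z := by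
  obtain ⟨-, M, hM, hP⟩ := hlin
  refine ⟨M *ᵥ V, fun i => ?_, fun x => ?_⟩
  · calc |(M *ᵥ V) i| ≤ ∑ s, |M i s| * |V s| := by
          refine (Finset.abs_sum_le_sum_abs _ _).trans_eq ?_
          simp only [abs_mul]
      _ ≤ ∑ s, |M i s| * B :=
          Finset.sum_le_sum fun s _ => mul_le_mul_of_nonneg_left (hV s) (abs_nonneg _)
      _ ≤ 1 * B := by
          rw [← Finset.sum_mul]
          exact mul_le_mul_of_nonneg_right (hM i) hB
      _ = B := one_mul B
  · calc avg (m.P x.1 x.2) V = ∑ s, (Φ * M) x s * V s := by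
          simp only [avg, hP]
      _ = (Φ *ᵥ (M *ᵥ V)) x := by
          rw [mulVec_mulVec]
          rfl
      _ = Φ x ⬝ᵥ (M *ᵥ V) := rfl

/-- A bound on the noise in every direction bounds the regression error by the bonus. -/
theorem abs_regress_sub_le_bonus {m : MDP S A} {Φ : Features S A d} (hlin : IsLinear m Φ)
    (D : Batch S A τ) {V : S → ℝ} {B β t : ℝ} (hB : 0 ≤ B) (hV : ∀ s, |V s| ≤ B) (ht : 0 < t)
    (hβ : 2 * √d * B ≤ β)
    (hnoise : ∀ w : Fin d → ℝ, w ⬝ᵥ w + ∑ i, (feat Φ D i ⬝ᵥ w) ^ 2 ≤ t ^ 2 →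
      noise m Φ D V w ≤ t * β / 2)
    (x : S × A) : |Φ x ⬝ᵥ regress Φ D V - avg (m.P x.1 x.2) V| ≤ bonus Φ β D x := by
  obtain ⟨z, hz, hPV⟩ := exists_avg_eq_dotProduct hlin hB hV
  set u := (covariance Φ D)⁻¹ *ᵥ Φ x with hu
  set q := √(invSq Φ D (Φ x)) with hq
  have hq0 : 0 ≤ q := Real.sqrt_nonneg _
  have hq2 : q ^ 2 = u ⬝ᵥ u + ∑ i, (feat Φ D i ⬝ᵥ u) ^ 2 := by
    rw [hq, Real.sq_sqrt (invSq_nonneg _ _ _), invSq_eq]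
  -- Expanding `⟨φ, z⟩` through `φ = Λu` removes the conditional means. What is left is the noise in
  -- direction `u` and the ridge bias `⟨u, z⟩`; each receives half of `β`.
  have hdiff : Φ x ⬝ᵥ regress Φ D V - avg (m.P x.1 x.2) V = noise m Φ D V u - u ⬝ᵥ z := by
    have h : ∀ i, avg (m.P (D i).1 (D i).2.1) V = feat Φ D i ⬝ᵥ z := fun i =>
      hPV ((D i).1, (D i).2.1)
    rw [hPV x, dotProduct_regress, dotProduct_inv_covariance_eq Φ D (Φ x) z, noise]
    simp only [h, mul_sub, Finset.sum_sub_distrib]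
    ring
  have huz : |u ⬝ᵥ z| ≤ q * (√d * B) := by
    refine (abs_dotProduct_le_sqrt u z).trans ?_
    refine mul_le_mul (Real.sqrt_le_sqrt (inv_dotProduct_self_le_invSq Φ D _)) ?_
      (Real.sqrt_nonneg _) hq0
    rw [← Real.sqrt_sq hB, ← Real.sqrt_mul (Nat.cast_nonneg d)]
    refine Real.sqrt_le_sqrt ?_
    calc z ⬝ᵥ z ≤ ∑ _i : Fin d, B ^ 2 := Finset.sum_le_sum fun i _ => by
          rw [← sq, ← sq_abs]
          exact pow_le_pow_left₀ (abs_nonneg _) (hz i) 2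
      _ = d * B ^ 2 := by simp
  -- The noise is linear in the direction, so `u` may be rescaled to `Λ`-length `t`; both signs give
  -- the absolute value. If `q = 0` then `u = 0`.
  have hnu : |noise m Φ D V u| ≤ q * (β / 2) := by
    rcases hq0.eq_or_lt with h0 | hpos
    · rw [← h0, zero_pow two_ne_zero] at hq2
      have h1 : 0 ≤ ∑ i, (feat Φ D i ⬝ᵥ u) ^ 2 := Finset.sum_nonneg fun _ _ => sq_nonneg _
      have h2 : u = 0 := dotProduct_self_eq_zero.mp
        (le_antisymm (by linarith) (dotProduct_self_nonneg' u))
      rw [h2, ← h0]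
      simp [noise]
    · have key : ∀ c : ℝ, c ^ 2 = (t / q) ^ 2 → c * noise m Φ D V u ≤ t * β / 2 := by
        intro c hc
        rw [← noise_smul]
        apply hnoise
        simp only [dotProduct_smul, smul_dotProduct, smul_eq_mul, mul_pow, hc, ← Finset.mul_sum]
        refine le_of_eq ?_
        calc c * (c * u ⬝ᵥ u) + (t / q) ^ 2 * ∑ i, (feat Φ D i ⬝ᵥ u) ^ 2
            = (t / q) ^ 2 * (u ⬝ᵥ u + ∑ i, (feat Φ D i ⬝ᵥ u) ^ 2) := by
              rw [← hc]
              ring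
          _ = t ^ 2 := by
              rw [← hq2]
              field_simp
      have h1 := key (t / q) rfl
      have h2 := key (-(t / q)) (by ring)
      have h3 : ∀ y : ℝ, t / q * y ≤ t * β / 2 → y ≤ q * (β / 2) := by
        intro y hy
        have := mul_le_mul_of_nonneg_left hy (div_pos hpos ht).le
        calc y = q / t * (t / q * y) := by field_simp
          _ ≤ q / t * (t * β / 2) := this
          _ = q * (β / 2) := by field_simp
      rw [abs_le]
      exact ⟨by linarith [h3 (-noise m Φ D V u) (by linarith)], h3 _ h1⟩
  rw [hdiff, bonus_eq]
  calc |noise m Φ D V u - u ⬝ᵥ z| ≤ |noise m Φ D V u| + |u ⬝ᵥ z| := abs_sub _ _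
    _ ≤ q * (β / 2) + q * (√d * B) := add_le_add hnu huz
    _ = q * (β / 2 + √d * B) := by ring
    _ ≤ q * β := mul_le_mul_of_nonneg_left (by linarith) hq0
    _ = β * q := mul_comm _ _

/-- The exponent of the test martingale for the direction `w` and the value function `V`. -/
def score (B : ℝ) (D : Batch S A τ) (V : S → ℝ) (w : Fin d → ℝ) : ℝ :=
  noise m Φ D V w - B ^ 2 / 2 * ∑ i, (feat Φ D i ⬝ᵥ w) ^ 2

/-- Given `(s, a)`, Hoeffding's lemma bounds the exponential moment of the centred value by
`exp(B²⟨φ, w⟩²/2)`, exactly what the score subtracts. Independence then multiplies factors of mean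
at most one. -/
theorem avg_exp_score_le [Fintype A] (π : Policy S A) {V : S → ℝ} {B : ℝ}
    (hV : ∀ s, |V s| ≤ B) (w : Fin d → ℝ) :
    avg (iid (sampleTransition m π) τ) (fun D => Real.exp (score m Φ B D V w)) ≤ 1 := by
  set f : S × A × S → ℝ := fun y => Real.exp ((Φ (y.1, y.2.1) ⬝ᵥ w) *
    (V y.2.2 - avg (m.P y.1 y.2.1) V) - B ^ 2 / 2 * (Φ (y.1, y.2.1) ⬝ᵥ w) ^ 2)
  have h1 : (fun D : Batch S A τ => Real.exp (score m Φ B D V w)) = fun D => ∏ i, f (D i) := by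
    funext D
    rw [← Real.exp_sum, score, noise, Finset.mul_sum, ← Finset.sum_sub_distrib]
    rfl
  have h2 : avg (sampleTransition m π) f ≤ 1 := by
    rw [avg_sampleTransition, ← avg_const (sampleOccupancy m π) 1]
    refine avg_mono _ fun x => ?_
    set c := Φ x ⬝ᵥ w
    set μ := avg (m.P x.1 x.2) V
    have h3 := avg_exp_mul_le (m.P x.1 x.2) hV c
    calc avg (m.P x.1 x.2) (fun s => f (x.1, x.2, s))
        = Real.exp (-(c * μ + B ^ 2 * c ^ 2 / 2)) *
            avg (m.P x.1 x.2) fun s => Real.exp (c * V s) := by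
          rw [← avg_const_mul]
          refine congrArg _ (funext fun s => ?_)
          rw [← Real.exp_add]
          change Real.exp (c * (V s - μ) - B ^ 2 / 2 * c ^ 2) = _
          congr 1
          ring
      _ ≤ Real.exp (-(c * μ + B ^ 2 * c ^ 2 / 2)) * Real.exp (c * μ + B ^ 2 * c ^ 2 / 2) :=
          mul_le_mul_of_nonneg_left h3 (Real.exp_pos _).le
      _ = 1 := by rw [← Real.exp_add, neg_add_cancel, Real.exp_zero]
  rw [h1, avg_iid_prod]
  refine pow_le_one₀ (avg_nonneg _ fun y => (Real.exp_pos _).le) h2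

/-- Markov's inequality for the sum of the exponentials, that is, a union bound over a finite family
fixed before the dataset is drawn. -/
theorem avg_indicator_score_le [Fintype A] (π : Policy S A) {ι : Type*} (s : Finset ι)
    (V : ι → S → ℝ) (w : ι → Fin d → ℝ) {B L : ℝ} (hV : ∀ p, ∀ s, |V p s| ≤ B)
    (bad : Set (Batch S A τ))
    (hbad : ∀ D ∈ bad, ∃ p ∈ s, L ≤ score m Φ B D (V p) (w p)) :
    avg (iid (sampleTransition m π) τ) (bad.indicator fun _ => 1) ≤ Real.exp (-L) * s.card := by
  calc avg (iid (sampleTransition m π) τ) (bad.indicator fun _ => 1)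
      ≤ avg (iid (sampleTransition m π) τ) fun D =>
          Real.exp (-L) * ∑ p ∈ s, Real.exp (score m Φ B D (V p) (w p)) := by
        refine avg_mono _ fun D => ?_
        by_cases hD : D ∈ bad
        · obtain ⟨p, hp, hL⟩ := hbad D hD
          rw [Set.indicator_of_mem hD]
          calc (1 : ℝ) ≤ Real.exp (-L) * Real.exp (score m Φ B D (V p) (w p)) := by
                rw [← Real.exp_add]
                exact Real.one_le_exp (by linarith)
            _ ≤ _ := mul_le_mul_of_nonneg_left
                (Finset.single_le_sum (f := fun p => Real.exp (score m Φ B D (V p) (w p)))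
                  (fun _ _ => (Real.exp_pos _).le) hp) (Real.exp_pos _).le
        · rw [Set.indicator_of_notMem hD]
          exact mul_nonneg (Real.exp_pos _).le (Finset.sum_nonneg fun _ _ => (Real.exp_pos _).le)
    _ = Real.exp (-L) * ∑ p ∈ s,
          avg (iid (sampleTransition m π) τ) fun D => Real.exp (score m Φ B D (V p) (w p)) := by
        rw [avg_const_mul, avg_sum]
    _ ≤ Real.exp (-L) * ∑ _p ∈ s, 1 :=
        mul_le_mul_of_nonneg_left (Finset.sum_le_sum fun p _ => avg_exp_score_le m Φ π (hV p) _)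
          (Real.exp_pos _).le
    _ = Real.exp (-L) * s.card := by simp

/-- The noise is controlled by the score of a nearby direction and a nearby value function. -/
theorem noise_le_score_add (hΦ : ∀ x, ∑ i, |Φ x i| ≤ 1) (D : Batch S A τ) {V V' : S → ℝ}
    {w w' : Fin d → ℝ} {B t h ρ : ℝ} (ht : 0 ≤ t) (hh : 0 ≤ h)
    (hw : ∀ i, |w i| ≤ t) (hww : ∀ i, |w i - w' i| ≤ h) (hV' : ∀ s, |V' s| ≤ B)
    (hVV : ∀ s, |V s - V' s| ≤ ρ) :
    noise m Φ D V w ≤ score m Φ B D V' w' + B ^ 2 / 2 * ∑ i, (feat Φ D i ⬝ᵥ w) ^ 2 +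
      τ * (2 * t * ρ + 2 * B * h + B ^ 2 * h * (2 * t + h) / 2) := by
  have key : ∀ i : Fin τ,
      (feat Φ D i ⬝ᵥ w) * (V (D i).2.2 - avg (m.P (D i).1 (D i).2.1) V) ≤
      (feat Φ D i ⬝ᵥ w') * (V' (D i).2.2 - avg (m.P (D i).1 (D i).2.1) V') -
        B ^ 2 / 2 * (feat Φ D i ⬝ᵥ w') ^ 2 + B ^ 2 / 2 * (feat Φ D i ⬝ᵥ w) ^ 2 +
        (2 * t * ρ + 2 * B * h + B ^ 2 * h * (2 * t + h) / 2) := by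
    intro i
    set a := feat Φ D i ⬝ᵥ w
    set a' := feat Φ D i ⬝ᵥ w'
    set ξ := V (D i).2.2 - avg (m.P (D i).1 (D i).2.1) V with hξ
    set ξ' := V' (D i).2.2 - avg (m.P (D i).1 (D i).2.1) V' with hξ'
    have ha : |a| ≤ t := abs_dotProduct_le_of_sum_abs ht (hΦ _) hw
    have haa : |a - a'| ≤ h := by
      simp only [a, a', ← dotProduct_sub]
      exact abs_dotProduct_le_of_sum_abs hh (hΦ _) hww
    have hξb : |ξ'| ≤ 2 * B := by
      have h1 := abs_sub (V' (D i).2.2) (avg (m.P (D i).1 (D i).2.1) V')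
      linarith [hV' (D i).2.2, abs_avg_le (m.P (D i).1 (D i).2.1) hV']
    have hξξ : |ξ - ξ'| ≤ 2 * ρ := by
      have h1 := abs_sub (V (D i).2.2 - V' (D i).2.2)
        (avg (m.P (D i).1 (D i).2.1) V - avg (m.P (D i).1 (D i).2.1) V')
      have h2 : ξ - ξ' = (V (D i).2.2 - V' (D i).2.2) -
        (avg (m.P (D i).1 (D i).2.1) V - avg (m.P (D i).1 (D i).2.1) V') := by
        rw [hξ, hξ']
        ring
      rw [h2]
      linarith [hVV (D i).2.2, abs_avg_sub_avg_le (m.P (D i).1 (D i).2.1) hVV]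
    have h1 : a * (ξ - ξ') ≤ t * (2 * ρ) := by
      refine (le_abs_self _).trans ?_
      rw [abs_mul]
      exact mul_le_mul ha hξξ (abs_nonneg _) ht
    have h2 : (a - a') * ξ' ≤ h * (2 * B) := by
      refine (le_abs_self _).trans ?_
      rw [abs_mul]
      exact mul_le_mul haa hξb (abs_nonneg _) hh
    have h3 : a' ^ 2 - a ^ 2 ≤ h * (2 * t + h) := by
      have e : a' ^ 2 - a ^ 2 = (a - a') * (-(a + a')) := by ring
      rw [e]
      refine (le_abs_self _).trans ?_
      rw [abs_mul, abs_neg]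
      refine mul_le_mul haa ?_ (abs_nonneg _) hh
      have e2 : a + a' = 2 * a - (a - a') := by ring
      rw [e2]
      refine (abs_sub _ _).trans (add_le_add ?_ haa)
      rw [abs_mul, abs_two]
      linarith
    have h4 := mul_le_mul_of_nonneg_left h3 (by positivity : 0 ≤ B ^ 2 / 2)
    have e3 : a * ξ = a' * ξ' + a * (ξ - ξ') + (a - a') * ξ' := by ring
    linarith
  calc noise m Φ D V w ≤ ∑ i : Fin τ, _ := Finset.sum_le_sum fun i _ => key i
    _ = _ := by
      simp only [Finset.sum_add_distrib, Finset.sum_sub_distrib, ← Finset.mul_sum,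
        Finset.sum_const, Finset.card_univ, Fintype.card_fin, nsmul_eq_mul, score, noise]
      ring

end Regression

/-! ### Value functions of the learner -/

section Candidates

open Matrix

/-- Clipping to `[-B, B]`. -/
def clip (B y : ℝ) : ℝ := max (-B) (min B y)

theorem abs_clip_le {B : ℝ} (hB : 0 ≤ B) (y : ℝ) : |clip B y| ≤ B :=
  abs_le.mpr ⟨le_max_left _ _, max_le (by linarith) (min_le_left _ _)⟩

theorem abs_clip_sub_clip_le (B y z : ℝ) : |clip B y - clip B z| ≤ |y - z| := by
  refine (abs_max_sub_max_le_max _ _ _ _).trans ?_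
  rw [sub_self, abs_zero, max_eq_right (abs_nonneg _)]
  refine (abs_min_sub_min_le_max _ _ _ _).trans ?_
  rw [sub_self, abs_zero, max_eq_right (abs_nonneg _)]

theorem abs_sqrt_sub_sqrt_le (a b : ℝ) : |√a - √b| ≤ √|a - b| := by
  have key : ∀ a b : ℝ, √a - √b ≤ √|a - b| := by
    intro a b
    rw [sub_le_iff_le_add]
    refine Real.sqrt_le_iff.mpr ⟨by positivity, ?_⟩
    have h1 := Real.sq_sqrt (abs_nonneg (a - b))
    have h2 : b ≤ √b ^ 2 := by
      rcases le_total 0 b with hb | hb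
      · rw [Real.sq_sqrt hb]
      · exact hb.trans (sq_nonneg _)
    nlinarith [le_abs_self (a - b), mul_nonneg (Real.sqrt_nonneg |a - b|) (Real.sqrt_nonneg b)]
  rw [abs_le]
  refine ⟨?_, key a b⟩
  have := key b a
  rw [abs_sub_comm] at this
  linarith

variable {S A : Type*} [Fintype A] {d : ℕ}

/-- The value function `s ↦ ∑ₐ π(a | s) [⟨φ, θ⟩ - β √⟨φ, G φ⟩]`, with the bracket clipped. -/
def candidateValue (B β : ℝ) (Φ : Features S A d) (π : Policy S A) (θ : Fin d → ℝ)
    (G : Matrix (Fin d) (Fin d) ℝ) (s : S) : ℝ :=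
  avg (π s) fun a => clip B (Φ (s, a) ⬝ᵥ θ - β * √(Φ (s, a) ⬝ᵥ G *ᵥ Φ (s, a)))

theorem abs_candidateValue_le {B : ℝ} (hB : 0 ≤ B) (β : ℝ) (Φ : Features S A d)
    (π : Policy S A) (θ : Fin d → ℝ) (G : Matrix (Fin d) (Fin d) ℝ) (s : S) :
    |candidateValue B β Φ π θ G s| ≤ B :=
  abs_avg_le _ fun _ => abs_clip_le hB _

/-- Averaging and clipping do not expand distances, and `‖φ‖₁ ≤ 1` transfers entrywise errors. The
square root in the bonus is only Hölder continuous of exponent `1/2`, hence the term `β√h`. -/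
theorem abs_candidateValue_sub_le {Φ : Features S A d} (hΦ : ∀ x, ∑ i, |Φ x i| ≤ 1) (B : ℝ)
    {β h : ℝ} (hβ : 0 ≤ β) (hh : 0 ≤ h) (π : Policy S A) {θ θ' : Fin d → ℝ}
    {G G' : Matrix (Fin d) (Fin d) ℝ} (hθ : ∀ i, |θ i - θ' i| ≤ h)
    (hG : ∀ i j, |G i j - G' i j| ≤ h) (s : S) :
    |candidateValue B β Φ π θ G s - candidateValue B β Φ π θ' G' s| ≤ h + β * √h := by
  refine abs_avg_sub_avg_le _ fun a => (abs_clip_sub_clip_le _ _ _).trans ?_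
  set φ := Φ (s, a)
  have h1 : |φ ⬝ᵥ θ - φ ⬝ᵥ θ'| ≤ h := by
    rw [← dotProduct_sub]
    exact abs_dotProduct_le_of_sum_abs hh (hΦ _) hθ
  have h2 : |φ ⬝ᵥ G *ᵥ φ - φ ⬝ᵥ G' *ᵥ φ| ≤ h := by
    rw [← dotProduct_sub, ← sub_mulVec]
    refine abs_dotProduct_le_of_sum_abs hh (hΦ _) fun i => ?_
    rw [mulVec, dotProduct_comm]
    exact abs_dotProduct_le_of_sum_abs hh (hΦ _) fun j => hG i j
  have h3 := (abs_sqrt_sub_sqrt_le (φ ⬝ᵥ G *ᵥ φ) (φ ⬝ᵥ G' *ᵥ φ)).trans (Real.sqrt_le_sqrt h2)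
  have h4 : φ ⬝ᵥ θ - β * √(φ ⬝ᵥ G *ᵥ φ) - (φ ⬝ᵥ θ' - β * √(φ ⬝ᵥ G' *ᵥ φ)) =
      (φ ⬝ᵥ θ - φ ⬝ᵥ θ') - β * (√(φ ⬝ᵥ G *ᵥ φ) - √(φ ⬝ᵥ G' *ᵥ φ)) := by ring
  rw [h4]
  refine (abs_sub _ _).trans (add_le_add h1 ?_)
  rw [abs_mul, abs_of_nonneg hβ]
  exact mul_le_mul_of_nonneg_left h3 hβ

end Candidates

/-! ### Uniform concentration -/

section Uniform

open Matrix

theorem floor_div_mem_Icc {x R h : ℝ} {N : ℕ} (hh : 0 < h) (hx : |x| ≤ R) (hN : R / h ≤ N) :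
    ⌊x / h⌋ ∈ Finset.Icc (-(N : ℤ)) N := by
  have h1 : |x / h| ≤ N := by
    rw [abs_div, abs_of_pos hh]
    exact (div_le_div_of_nonneg_right hx hh.le).trans hN
  rw [abs_le] at h1
  rw [Finset.mem_Icc]
  refine ⟨Int.le_floor.mpr (by push_cast; exact h1.1), ?_⟩
  have h2 := (Int.floor_le (x / h)).trans h1.2
  exact_mod_cast h2

theorem abs_sub_mul_floor_le {h : ℝ} (hh : 0 < h) (x : ℝ) : |x - h * ⌊x / h⌋| ≤ h := by
  have h1 := mul_le_mul_of_nonneg_left (Int.floor_le (x / h)) hh.le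
  have h2 := mul_lt_mul_of_pos_left (Int.lt_floor_add_one (x / h)) hh
  rw [mul_div_cancel₀ _ hh.ne'] at h1 h2
  rw [abs_le]
  constructor <;> linarith

/-- The integer points of a cube. -/
def gridBox (ι : Type*) [Fintype ι] [DecidableEq ι] (N : ℕ) : Finset (ι → ℤ) :=
  Fintype.piFinset fun _ => Finset.Icc (-(N : ℤ)) N

theorem card_gridBox (ι : Type*) [Fintype ι] [DecidableEq ι] (N : ℕ) :
    (gridBox ι N).card = (2 * N + 1) ^ Fintype.card ι := by
  have h : (Finset.Icc (-(N : ℤ)) N).card = 2 * N + 1 := by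
    rw [Int.card_Icc]
    omega
  simp [gridBox, h]

variable {S A : Type*} [Fintype S] [Fintype A] {d τ : ℕ}

/-- With high probability over the dataset, the bonus dominates the regression error for a given
value function and simultaneously for all candidate value functions. -/
theorem avg_indicator_regress_le {m : MDP S A} {Φ : Features S A d} (hlin : IsLinear m Φ)
    (π : Policy S A) {V₀ : S → ℝ} {B β h R L : ℝ} {N : ℕ} (hB : 0 < B) (hβ : 0 < β) (hh : 0 < h)
    (hV₀ : ∀ s, |V₀ s| ≤ B) (hR : 1 ≤ R) (hβR : β / (2 * B ^ 2) ≤ R) (hN : R / h ≤ N)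
    (hdB : 2 * √d * B ≤ β)
    (hL : L + τ * (2 * (β / (2 * B ^ 2)) * (h + β * √h) + 2 * B * h +
      B ^ 2 * h * (2 * (β / (2 * B ^ 2)) + h) / 2) ≤ β ^ 2 / (8 * B ^ 2))
    (bad : Set (Batch S A τ))
    (hbad : ∀ D ∈ bad, ∃ V : S → ℝ, (V = V₀ ∨ ∃ θ : Fin d → ℝ, (∀ i, |θ i| ≤ R) ∧
        V = candidateValue B β Φ π θ (covariance Φ D)⁻¹) ∧
      ∃ x, bonus Φ β D x < |Φ x ⬝ᵥ regress Φ D V - avg (m.P x.1 x.2) V|) :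
    avg (iid (sampleTransition m π) τ) (bad.indicator fun _ => 1) ≤
      Real.exp (-L) * (2 * (2 * N + 1) ^ (2 * d + d ^ 2)) := by
  classical
  -- This radius maximizes `tβ/2 - B²t²/2`. The maximum `β²/(8B²)` is the room for the deviation
  -- level `L` and the discretization error.
  set t := β / (2 * B ^ 2) with ht
  have ht0 : 0 < t := by positivity
  set ρ := h + β * √h with hρ
  have hρ0 : 0 ≤ ρ := by positivity
  -- The coordinates are the direction, `θ` and the matrix `G`, hence the exponent `d + d + d²`. The
  -- value `none` stands for `V₀`, which needs no discretization and accounts for the factor two.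
  let grid : Finset ((Fin d → ℤ) × Option ((Fin d → ℤ) × (Fin d × Fin d → ℤ))) :=
    gridBox (Fin d) N ×ˢ Finset.insertNone (gridBox (Fin d) N ×ˢ gridBox (Fin d × Fin d) N)
  let wt : (Fin d → ℤ) × Option ((Fin d → ℤ) × (Fin d × Fin d → ℤ)) → Fin d → ℝ :=
    fun p i => h * p.1 i
  let Vt : (Fin d → ℤ) × Option ((Fin d → ℤ) × (Fin d × Fin d → ℤ)) → S → ℝ :=
    fun p => p.2.elim V₀ fun g => candidateValue B β Φ π (fun i => h * g.1 i)
      (Matrix.of fun i j => h * g.2 (i, j))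
  have hVt : ∀ p s, |Vt p s| ≤ B := by
    rintro ⟨p, _ | g⟩ s
    · exact hV₀ s
    · exact abs_candidateValue_le hB.le _ _ _ _ _ _
  have hcard : (grid.card : ℝ) ≤ 2 * (2 * N + 1) ^ (2 * d + d ^ 2) := by
    have h1 : grid.card = (2 * N + 1) ^ d * ((2 * N + 1) ^ d * (2 * N + 1) ^ (d * d) + 1) := by
      simp only [grid, Finset.card_product, Finset.card_insertNone, card_gridBox,
        Fintype.card_fin, Fintype.card_prod]
    have h2 : grid.card ≤ 2 * (2 * N + 1) ^ (2 * d + d ^ 2) := by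
      rw [h1, ← pow_add]
      have h3 : 1 ≤ (2 * N + 1) ^ (d + d * d) := Nat.one_le_pow _ _ (by omega)
      calc (2 * N + 1) ^ d * ((2 * N + 1) ^ (d + d * d) + 1)
          ≤ (2 * N + 1) ^ d * ((2 * N + 1) ^ (d + d * d) + (2 * N + 1) ^ (d + d * d)) :=
            Nat.mul_le_mul_left _ (by omega)
        _ = 2 * (2 * N + 1) ^ (2 * d + d ^ 2) := by ring
    exact_mod_cast h2
  refine (avg_indicator_score_le m Φ π grid Vt wt hVt bad (L := L) ?_).trans
    (mul_le_mul_of_nonneg_left hcard (Real.exp_pos _).le)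
  intro D hD
  obtain ⟨V, hV, x, hx⟩ := hbad D hD
  by_contra! hall
  have hVB : ∀ s, |V s| ≤ B := by
    rcases hV with rfl | ⟨θ, -, rfl⟩
    · exact hV₀
    · exact abs_candidateValue_le hB.le _ _ _ _ _
  refine absurd hx (not_lt.mpr (abs_regress_sub_le_bonus hlin D hB.le hVB ht0 hdB ?_ x))
  intro w hw
  have hsum : 0 ≤ ∑ i, (feat Φ D i ⬝ᵥ w) ^ 2 := Finset.sum_nonneg fun _ _ => sq_nonneg _
  have hwt : ∀ i, |w i| ≤ t := fun i => by
    have h1 : w i * w i ≤ w ⬝ᵥ w := Finset.single_le_sum (f := fun i => w i * w i)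
      (fun _ _ => mul_self_nonneg _) (Finset.mem_univ i)
    exact abs_le_of_sq_le_sq (by nlinarith) ht0.le
  have hgrid : ∃ o ∈ Finset.insertNone (gridBox (Fin d) N ×ˢ gridBox (Fin d × Fin d) N),
      ∀ s, |V s - Vt ((fun i => ⌊w i / h⌋), o) s| ≤ ρ := by
    rcases hV with rfl | ⟨θ, hθ, rfl⟩
    · exact ⟨none, by simp, fun s => by simpa [Vt] using hρ0⟩
    · refine ⟨some ((fun i => ⌊θ i / h⌋), fun ij => ⌊(covariance Φ D)⁻¹ ij.1 ij.2 / h⌋), ?_, ?_⟩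
      · rw [Finset.some_mem_insertNone, Finset.mem_product]
        refine ⟨Fintype.mem_piFinset.mpr fun i => floor_div_mem_Icc hh (hθ i) hN,
          Fintype.mem_piFinset.mpr fun ij => floor_div_mem_Icc hh
            ((abs_inv_covariance_apply_le Φ D _ _).trans hR) hN⟩
      · exact abs_candidateValue_sub_le hlin.1 B hβ.le hh.le π
          (fun i => abs_sub_mul_floor_le hh _) fun i j => abs_sub_mul_floor_le hh _
  obtain ⟨o, ho, hVo⟩ := hgrid
  have hmem : ((fun i => ⌊w i / h⌋), o) ∈ grid := Finset.mem_product.mpr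
    ⟨Fintype.mem_piFinset.mpr fun i => floor_div_mem_Icc hh ((hwt i).trans hβR) hN, ho⟩
  have h1 := hall _ hmem
  have h2 := noise_le_score_add m Φ hlin.1 D ht0.le hh.le hwt
    (fun i => abs_sub_mul_floor_le hh (w i)) (hVt ((fun i => ⌊w i / h⌋), o)) hVo
  have h3 : B ^ 2 / 2 * ∑ i, (feat Φ D i ⬝ᵥ w) ^ 2 ≤ B ^ 2 / 2 * t ^ 2 :=
    mul_le_mul_of_nonneg_left (by linarith [dotProduct_self_nonneg' w]) (by positivity)
  have h4 : B ^ 2 / 2 * t ^ 2 = β ^ 2 / (8 * B ^ 2) := by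
    rw [ht]
    field_simp
    ring
  have h5 : t * β / 2 = β ^ 2 / (8 * B ^ 2) + β ^ 2 / (8 * B ^ 2) := by
    rw [ht]
    field_simp
    ring
  change score m Φ B D (Vt ((fun i => ⌊w i / h⌋), o)) (fun i => h * ⌊w i / h⌋) < L at h1
  linarith

end Uniform

/-! ### Regret on the good event -/

section Regret

open Matrix

variable {S A : Type*} {d τ : ℕ}

theorem abs_linCost_le {Φ : Features S A d} (hΦ : ∀ x, ∑ i, |Φ x i| ≤ 1)
    {w : EuclideanSpace ℝ (Fin d)} (hw : ‖w‖ ≤ 1) (x : S × A) : |linCost Φ w x| ≤ 1 :=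
  abs_dotProduct_le_of_sum_abs (v := fun i => w i) zero_le_one (hΦ x) fun i =>
    (PiLp.norm_apply_le w i).trans hw

theorem one_le_inv_one_sub (m : MDP S A) : 1 ≤ (1 - m.γ)⁻¹ :=
  (one_le_inv₀ (by linarith [m.γ_lt_one])).mpr (by linarith [m.γ_nonneg])

theorem one_add_mul_inv_one_sub (m : MDP S A) : 1 + m.γ * (1 - m.γ)⁻¹ = (1 - m.γ)⁻¹ := by
  have : 1 - m.γ ≠ 0 := by linarith [m.γ_lt_one]
  field_simp
  ring

theorem rtake_cons_of_le {α : Type*} (a : α) (l : List α) {n : ℕ} (h : n ≤ l.length) :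
    (a :: l).rtake n = l.rtake n := by
  rw [List.rtake, List.rtake, List.length_cons, Nat.succ_sub h, List.drop_succ_cons]

theorem rtake_of_length_le {α : Type*} (l : List α) {n : ℕ} (h : l.length ≤ n) :
    l.rtake n = l := by
  rw [List.rtake, Nat.sub_eq_zero_of_le h, List.drop_zero]

section OneStep

variable [Fintype S] [Fintype A] {m : MDP S A} {Φ : Features S A d} {D : Batch S A τ}
  {β : ℝ} {c : S × A → ℝ} {V : S → ℝ}

omit [Fintype A] in
/-- The update is an optimistic application of the Bellman operator. -/
theorem optimisticQ_mem_Icc (hc : ∀ x, |c x| ≤ 1)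
    (hV : ∀ s, |V s| ≤ (1 - m.γ)⁻¹)
    (hgood : ∀ x, |Φ x ⬝ᵥ regress Φ D V - avg (m.P x.1 x.2) V| ≤ bonus Φ β D x) (x : S × A) :
    c x + m.γ * avg (m.P x.1 x.2) V - 2 * bonus Φ β D x ≤ optimisticQ m.γ β Φ D c V x ∧
      optimisticQ m.γ β Φ D c V x ≤ c x + m.γ * avg (m.P x.1 x.2) V := by
  have h0 : 0 ≤ bonus Φ β D x := (abs_nonneg _).trans (hgood x)
  have h1 := abs_le.mp (hgood x)
  have h2 := abs_le.mp (hc x)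
  have h3 := abs_le.mp (abs_avg_le (m.P x.1 x.2) hV)
  have h4 := one_add_mul_inv_one_sub m
  have h5 := m.γ_nonneg
  have h6 := m.γ_lt_one
  have h7 := one_le_inv_one_sub m
  set B := (1 - m.γ)⁻¹
  set p := avg (m.P x.1 x.2) V
  set y := Φ x ⬝ᵥ regress Φ D V
  set b := bonus Φ β D x
  have h8 : m.γ * (y - p) ≤ b := by nlinarith
  have h9 : -b ≤ m.γ * (y - p) := by nlinarith
  have h10 : m.γ * p ≤ m.γ * B := mul_le_mul_of_nonneg_left h3.2 h5
  have h11 : m.γ * -B ≤ m.γ * p := mul_le_mul_of_nonneg_left h3.1 h5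
  -- Clipping does no harm: `1 + γB = B` places `c + γPV` inside `[-B, B]`.
  change _ ≤ max (-B) (min B (c x + m.γ * y - b)) ∧ max (-B) (min B (c x + m.γ * y - b)) ≤ _
  refine ⟨le_max_of_le_right (le_min (by linarith) (by linarith)),
    max_le (by linarith) (min_le_of_right_le (by linarith))⟩

/-- Optimism bounds the learner's cost from above and the comparator's from below by `Q - γPV`, up
to twice the bonus for the learner. The flow equation converts `γ⟨d, PV⟩` into `⟨d, V⟩` minus a term
common to both policies. -/
theorem avg_cost_sub_le (hc : ∀ x, |c x| ≤ 1)
    (hV : ∀ s, |V s| ≤ (1 - m.γ)⁻¹)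
    (hgood : ∀ x, |Φ x ⬝ᵥ regress Φ D V - avg (m.P x.1 x.2) V| ≤ bonus Φ β D x)
    (π π' : Policy S A) :
    avg (sampleOccupancy m π) c - avg (sampleOccupancy m π') c ≤
      avg (sampleOccupancy m π)
        (fun x => avg (π x.1) fun a => optimisticQ m.γ β Φ D c V (x.1, a)) -
      avg (sampleOccupancy m π) (fun x => V x.1) +
      2 * avg (sampleOccupancy m π) (bonus Φ β D) -
      avg (sampleOccupancy m π') (optimisticQ m.γ β Φ D c V) +
      avg (sampleOccupancy m π') (fun x => V x.1) := by
  have h := optimisticQ_mem_Icc hc hV hgood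
  set Q := optimisticQ m.γ β Φ D c V
  have h1 : avg (sampleOccupancy m π) c ≤ avg (sampleOccupancy m π) Q -
      m.γ * avg (sampleOccupancy m π) (fun x => avg (m.P x.1 x.2) V) +
      2 * avg (sampleOccupancy m π) (bonus Φ β D) := by
    rw [← avg_const_mul, ← avg_const_mul, ← avg_sub, ← avg_add]
    exact avg_mono _ fun x => by linarith [(h x).1]
  have h2 : avg (sampleOccupancy m π') Q -
      m.γ * avg (sampleOccupancy m π') (fun x => avg (m.P x.1 x.2) V) ≤
      avg (sampleOccupancy m π') c := by
    rw [← avg_const_mul, ← avg_sub]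
    exact avg_mono _ fun x => by linarith [(h x).2]
  rw [← avg_sampleOccupancy_policy]
  linarith [avg_sampleOccupancy_state m π V, avg_sampleOccupancy_state m π' V]

end OneStep

variable [Fintype A] [Nonempty A] (m : MDP S A) (Φ : Features S A d) (β η : ℝ)
  (w : Adversary S A d τ)

/-- The iterates `(Q, V)` while the dataset `D` is processed after the history `H`. -/
def batchIter (D : Batch S A τ) (H : List (Batch S A τ)) (n : ℕ) : (S × A → ℝ) × (S → ℝ) :=
  evalIter m.γ β Φ D (learnerPolicy m.γ β η Φ w H)
    (fun n => linCost Φ (w (H.length * τ + n) (D :: H)))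
    ((learner m.γ β η Φ w H).Q, (learner m.γ β η Φ w H).V) n

theorem batchIter_succ (D : Batch S A τ) (H : List (Batch S A τ)) (n : ℕ) :
    (batchIter m Φ β η w D H (n + 1)).1 = optimisticQ m.γ β Φ D
      (linCost Φ (w (H.length * τ + n) (D :: H))) (batchIter m Φ β η w D H n).2 := rfl

theorem batchIter_succ_snd (D : Batch S A τ) (H : List (Batch S A τ)) (n : ℕ) (s : S) :
    (batchIter m Φ β η w D H (n + 1)).2 s = avg (learnerPolicy m.γ β η Φ w H s) fun a =>
      (batchIter m Φ β η w D H (n + 1)).1 (s, a) := rfl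

/-- The average of the `Q`-functions over a batch. -/
def batchMeanQ (D : Batch S A τ) (H : List (Batch S A τ)) (x : S × A) : ℝ :=
  (τ : ℝ)⁻¹ * ∑ n ∈ Finset.range τ, (batchIter m Φ β η w D H n).1 x

theorem learner_cons_sumQ (D : Batch S A τ) (H : List (Batch S A τ)) :
    (learner m.γ β η Φ w (D :: H)).sumQ =
      fun x => (learner m.γ β η Φ w H).sumQ x + batchMeanQ m Φ β η w D H x := rfl

theorem learner_cons_Q (D : Batch S A τ) (H : List (Batch S A τ)) :
    (learner m.γ β η Φ w (D :: H)).Q = (batchIter m Φ β η w D H τ).1 := rfl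

theorem learner_cons_V (D : Batch S A τ) (H : List (Batch S A τ)) :
    (learner m.γ β η Φ w (D :: H)).V = (batchIter m Φ β η w D H τ).2 := rfl

theorem batchIter_bound_of_learner {D : Batch S A τ} {H : List (Batch S A τ)}
    (hQ : ∀ x, |(learner m.γ β η Φ w H).Q x| ≤ (1 - m.γ)⁻¹)
    (hV : ∀ s, |(learner m.γ β η Φ w H).V s| ≤ (1 - m.γ)⁻¹) (n : ℕ) :
    (∀ x, |(batchIter m Φ β η w D H n).1 x| ≤ (1 - m.γ)⁻¹) ∧
      ∀ s, |(batchIter m Φ β η w D H n).2 s| ≤ (1 - m.γ)⁻¹ := by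
  cases n with
  | zero => exact ⟨hQ, hV⟩
  | succ n =>
    have h1 : ∀ x, |(batchIter m Φ β η w D H (n + 1)).1 x| ≤ (1 - m.γ)⁻¹ := fun x =>
      abs_clip_le (zero_le_one.trans (one_le_inv_one_sub m)) _
    exact ⟨h1, fun s => abs_avg_le _ fun a => h1 (s, a)⟩

theorem learner_bound (H : List (Batch S A τ)) :
    (∀ x, |(learner m.γ β η Φ w H).Q x| ≤ (1 - m.γ)⁻¹) ∧
      ∀ s, |(learner m.γ β η Φ w H).V s| ≤ (1 - m.γ)⁻¹ := by
  induction H with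
  | nil =>
    have h := zero_le_one.trans (one_le_inv_one_sub m)
    constructor <;> intro _ <;> simpa [learner] using h
  | cons D H ih => exact batchIter_bound_of_learner m Φ β η w ih.1 ih.2 τ

theorem batchIter_bound (D : Batch S A τ) (H : List (Batch S A τ)) (n : ℕ) :
    (∀ x, |(batchIter m Φ β η w D H n).1 x| ≤ (1 - m.γ)⁻¹) ∧
      ∀ s, |(batchIter m Φ β η w D H n).2 s| ≤ (1 - m.γ)⁻¹ :=
  batchIter_bound_of_learner m Φ β η w (learner_bound m Φ β η w H).1
    (learner_bound m Φ β η w H).2 n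

theorem abs_batchMeanQ_le (hτ : 0 < τ) (D : Batch S A τ) (H : List (Batch S A τ)) (x : S × A) :
    |batchMeanQ m Φ β η w D H x| ≤ (1 - m.γ)⁻¹ := by
  have hτ' : (0 : ℝ) < τ := Nat.cast_pos.mpr hτ
  rw [batchMeanQ, abs_mul, abs_of_pos (inv_pos.mpr hτ'), inv_mul_le_iff₀ hτ']
  refine (Finset.abs_sum_le_sum_abs _ _).trans ?_
  calc ∑ n ∈ Finset.range τ, |(batchIter m Φ β η w D H n).1 x|
      ≤ ∑ _n ∈ Finset.range τ, (1 - m.γ)⁻¹ :=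
        Finset.sum_le_sum fun n _ => (batchIter_bound m Φ β η w D H n).1 x
    _ = τ * (1 - m.γ)⁻¹ := by simp

theorem abs_avg_learnerPolicy_sub_le (hη : 0 < η) (hτ : 0 < τ) (D : Batch S A τ)
    (H : List (Batch S A τ)) (s : S) {C : ℝ} (g : A → ℝ) (hg : ∀ a, |g a| ≤ C) :
    |avg (learnerPolicy m.γ β η Φ w H s) g - avg (learnerPolicy m.γ β η Φ w (D :: H) s) g| ≤
      C * (4 * η * (1 - m.γ)⁻¹) :=
  abs_avg_softmaxPolicy_sub_le hη _ _ (abs_batchMeanQ_le m Φ β η w hτ D H) s g hg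

/-- The current value function is almost the average of the current `Q`-function under the next
policy. -/
theorem abs_learner_V_sub_le (hη : 0 < η) (hτ : 0 < τ) (H : List (Batch S A τ)) (s : S) :
    |(learner m.γ β η Φ w H).V s - avg (learnerPolicy m.γ β η Φ w H s) fun a =>
      (learner m.γ β η Φ w H).Q (s, a)| ≤ (1 - m.γ)⁻¹ * (4 * η * (1 - m.γ)⁻¹) := by
  have hB := zero_le_one.trans (one_le_inv_one_sub m)
  cases H with
  | nil =>
    have h : (0 : ℝ) ≤ (1 - m.γ)⁻¹ * (4 * η * (1 - m.γ)⁻¹) := by positivity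
    simpa [learner, avg_const] using h
  | cons D H =>
    obtain ⟨n, rfl⟩ := Nat.exists_eq_succ_of_ne_zero hτ.ne'
    rw [learner_cons_V, learner_cons_Q, batchIter_succ_snd]
    exact abs_avg_learnerPolicy_sub_le m Φ β η w hη hτ D H s _ fun a =>
      (batchIter_bound m Φ β η w D H _).1 (s, a)

variable [Fintype S]

/-- The bonus dominates all regression errors made while `D` is processed. -/
def goodBatch (D : Batch S A τ) (H : List (Batch S A τ)) : Prop :=
  ∀ n < τ, ∀ x, |Φ x ⬝ᵥ regress Φ D (batchIter m Φ β η w D H n).2 -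
    avg (m.P x.1 x.2) (batchIter m Φ β η w D H n).2| ≤ bonus Φ β D x

/-- The bonus dominates all regression errors. -/
def goodHistory : List (Batch S A τ) → Prop
  | [] => True
  | D :: H => goodBatch m Φ β η w D H ∧ goodHistory H

/-- The expectation of `‖φ‖` with respect to `Λ⁻¹` under the occupancy measure of the policy that
collected `D`. -/
def batchWidth (D : Batch S A τ) (H : List (Batch S A τ)) : ℝ :=
  avg (sampleOccupancy m (learnerPolicy m.γ β η Φ w H)) fun x => √(invSq Φ D (Φ x))

/-- The sum of the widths of all batches. -/
def sumWidth : List (Batch S A τ) → ℝ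
  | [] => 0
  | D :: H => batchWidth m Φ β η w D H + sumWidth H

/-- The potential that telescopes over the batches. -/
def potential (π' : Policy S A) (H : List (Batch S A τ)) : ℝ :=
  avg (sampleOccupancy m (learnerPolicy m.γ β η Φ w H))
      (fun x => (learner m.γ β η Φ w H).V x.1) -
    avg (sampleOccupancy m π') (learner m.γ β η Φ w H).Q -
    τ * (avg (sampleOccupancy m π') (fun x => freeEnergy η (learner m.γ β η Φ w H).sumQ x.1) +
      avg (sampleOccupancy m π') (learner m.γ β η Φ w H).sumQ)

theorem potential_nil (π' : Policy S A) :
    potential m Φ β η w π' [] = -(τ * Real.log (Fintype.card A) / η) := by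
  have h0 : (learner m.γ β η Φ w []).sumQ = 0 := rfl
  have h1 : (learner m.γ β η Φ w []).Q = fun _ => 0 := rfl
  have h2 : (learner m.γ β η Φ w []).V = fun _ => 0 := rfl
  have h3 : avg (sampleOccupancy m π') (0 : S × A → ℝ) = 0 := avg_const _ 0
  rw [potential, h0, h1, h2, h3]
  simp only [freeEnergy_zero, avg_const]
  ring

/-- The free energy dominates `-f(s, a)` for every action, so the part multiplied by `τ` has a
favourable sign and only the bounded V and Q terms remain. -/
theorem potential_le (hη : 0 < η) (π' : Policy S A) (H : List (Batch S A τ)) :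
    potential m Φ β η w π' H ≤ 2 * (1 - m.γ)⁻¹ := by
  have h1 := abs_le.mp (abs_avg_le (sampleOccupancy m (learnerPolicy m.γ β η Φ w H))
    fun x => (learner_bound m Φ β η w H).2 x.1)
  have h2 := abs_le.mp (abs_avg_le (sampleOccupancy m π') (learner_bound m Φ β η w H).1)
  have h3 : 0 ≤ avg (sampleOccupancy m π')
        (fun x => freeEnergy η (learner m.γ β η Φ w H).sumQ x.1) +
      avg (sampleOccupancy m π') (learner m.γ β η Φ w H).sumQ := by
    rw [← avg_add]
    exact avg_nonneg _ fun x => by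
      linarith [neg_le_freeEnergy hη (learner m.γ β η Φ w H).sumQ x.1 x.2]
  have h4 := mul_nonneg (Nat.cast_nonneg (α := ℝ) τ) h3
  rw [potential]
  linarith [h1.2, h2.1]

/-- The regret of one batch on the good event. -/
theorem batch_regret_le {m : MDP S A} {Φ : Features S A d} (hΦ : ∀ x, ∑ i, |Φ x i| ≤ 1)
    {β η : ℝ} (hη : 0 < η) (hτ : 0 < τ) {w : Adversary S A d τ}
    (π' : Policy S A) {D : Batch S A τ} {H : List (Batch S A τ)}
    (hw : ∀ n < τ, ‖w (H.length * τ + n) (D :: H)‖ ≤ 1) (hgood : goodBatch m Φ β η w D H) :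
    ∑ n ∈ Finset.range τ,
      (avg (sampleOccupancy m (learnerPolicy m.γ β η Φ w H))
        (linCost Φ (w (H.length * τ + n) (D :: H))) -
      avg (sampleOccupancy m π') (linCost Φ (w (H.length * τ + n) (D :: H)))) ≤
    potential m Φ β η w π' (D :: H) - potential m Φ β η w π' H +
      2 * τ * β * batchWidth m Φ β η w D H +
      (τ * η * (1 - m.γ)⁻¹ ^ 2 / 2 + 8 * η * (1 - m.γ)⁻¹ ^ 3) := by
  set B := (1 - m.γ)⁻¹ with hB
  have hB1 : 1 ≤ B := one_le_inv_one_sub m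
  set π := learnerPolicy m.γ β η Φ w H
  set It := batchIter m Φ β η w D H
  set dπ := sampleOccupancy m π
  set ds := sampleOccupancy m π'
  have hbound := batchIter_bound m Φ β η w D H
  -- Adding and subtracting `⟨d^⋆, Qₙ⟩` creates a second telescoping difference and leaves `⟨d^⋆, Vₙ
  -- - Qₙ⟩` for exponential weights.
  have hstep : ∀ n ∈ Finset.range τ,
      avg dπ (linCost Φ (w (H.length * τ + n) (D :: H))) -
        avg ds (linCost Φ (w (H.length * τ + n) (D :: H))) ≤
      (avg dπ (fun x => (It (n + 1)).2 x.1) - avg dπ (fun x => (It n).2 x.1)) +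
        2 * avg dπ (bonus Φ β D) + (avg ds (It n).1 - avg ds (It (n + 1)).1) +
        (avg ds (fun x => (It n).2 x.1) - avg ds (It n).1) := by
    intro n hn
    rw [Finset.mem_range] at hn
    have h := avg_cost_sub_le (abs_linCost_le hΦ (hw n hn)) (hbound n).2 (hgood n hn) π π'
    rw [← batchIter_succ] at h
    change _ ≤ avg dπ (fun x => (It (n + 1)).2 x.1) - avg dπ (fun x => (It n).2 x.1) +
      2 * avg dπ (bonus Φ β D) - avg ds (It (n + 1)).1 + avg ds (fun x => (It n).2 x.1) at h
    linarith
  -- Only the inherited `V₀` is not the average of `Q₀` under the current policy; it comes from the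
  -- preceding one, so `n = 0` pays one stability error.
  have hmd : ∀ n ∈ Finset.range τ, avg ds (fun x => (It n).2 x.1) - avg ds (It n).1 ≤
      avg ds (fun x => (avg (π x.1) fun a => (It n).1 (x.1, a)) - (It n).1 x) +
        if n = 0 then B * (4 * η * B) else 0 := by
    intro n _
    rw [← avg_sub, ← avg_const ds (if n = 0 then _ else _), ← avg_add]
    refine avg_mono _ fun x => ?_
    cases n with
    | zero =>
      have h := abs_le.mp (abs_learner_V_sub_le m Φ β η w hη hτ H x.1)
      have h1 := h.2
      rw [if_pos rfl]
      change (learner m.γ β η Φ w H).V x.1 - (learner m.γ β η Φ w H).Q x ≤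
        (avg (π x.1) fun a => (learner m.γ β η Φ w H).Q (x.1, a)) -
          (learner m.γ β η Φ w H).Q x + _
      linarith
    | succ n =>
      rw [if_neg (Nat.succ_ne_zero n), add_zero]
      exact (congrArg (· - _) (batchIter_succ_snd m Φ β η w D H n x.1)).le
  have hsum := Finset.sum_le_sum hstep
  have hsum2 := Finset.sum_le_sum hmd
  rw [Finset.sum_add_distrib, Finset.sum_add_distrib, Finset.sum_add_distrib,
    Finset.sum_range_sub (fun n => avg dπ (fun x => (It n).2 x.1)),
    Finset.sum_range_sub' (fun n => avg ds (It n).1), Finset.sum_const, Finset.card_range,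
    nsmul_eq_mul] at hsum
  rw [Finset.sum_add_distrib, Finset.sum_ite_eq_of_mem' _ _ _ (Finset.mem_range.mpr hτ),
    ← avg_sum] at hsum2
  have hmean : ∀ x, ∑ n ∈ Finset.range τ, (It n).1 x = τ * batchMeanQ m Φ β η w D H x := by
    intro x
    have : (τ : ℝ) ≠ 0 := Nat.cast_ne_zero.mpr hτ.ne'
    rw [batchMeanQ, mul_inv_cancel_left₀ this]
  -- Because the policy is constant, the batch amounts to `τ` copies of one exponential-weights
  -- round with the mean Q-function as loss.
  have hexp : avg ds (fun x => ∑ n ∈ Finset.range τ,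
      ((avg (π x.1) fun a => (It n).1 (x.1, a)) - (It n).1 x)) ≤
      τ * (avg ds (fun x => freeEnergy η (learner m.γ β η Φ w H).sumQ x.1) -
        avg ds (fun x => freeEnergy η (learner m.γ β η Φ w (D :: H)).sumQ x.1) + η * B ^ 2 / 2 -
        (avg ds (learner m.γ β η Φ w (D :: H)).sumQ - avg ds (learner m.γ β η Φ w H).sumQ)) := by
    rw [← avg_sub, ← avg_sub, ← avg_const ds (η * B ^ 2 / 2), ← avg_add, ← avg_sub,
      ← avg_const_mul]
    refine avg_mono _ fun x => ?_
    rw [Finset.sum_sub_distrib, ← avg_sum, hmean]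
    simp only [hmean, avg_const_mul]
    rw [← mul_sub]
    refine mul_le_mul_of_nonneg_left ?_ (Nat.cast_nonneg τ)
    have h := avg_softmaxPolicy_le hη (learner m.γ β η Φ w H).sumQ _
      (abs_batchMeanQ_le m Φ β η w hτ D H) x.1
    rw [← learner_cons_sumQ] at h
    have h2 : (learner m.γ β η Φ w (D :: H)).sumQ x - (learner m.γ β η Φ w H).sumQ x =
        batchMeanQ m Φ β η w D H x := by
      rw [learner_cons_sumQ]
      ring
    rw [h2]
    change avg (π x.1) _ ≤ _ at h
    linarith
  have hbonus : avg dπ (bonus Φ β D) = β * batchWidth m Φ β η w D H := by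
    rw [batchWidth, ← avg_const_mul]
    rfl
  -- The telescoped endpoint is measured under the old occupancy measure, while the potential uses
  -- that of the next policy. The change costs `4ηB³`, and the error at `n = 0` fits into another
  -- `4ηB³`.
  have hshift : avg dπ (fun x => (It τ).2 x.1) ≤
      avg (sampleOccupancy m (learnerPolicy m.γ β η Φ w (D :: H)))
        (fun x => (learner m.γ β η Φ w (D :: H)).V x.1) + B * (4 * η * B) * B := by
    have h := abs_le.mp (avg_sampleOccupancy_sub_le m π (learnerPolicy m.γ β η Φ w (D :: H))
      (by linarith) (by positivity) (fun s f hf =>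
        abs_avg_learnerPolicy_sub_le m Φ β η w hη hτ D H s f hf)
      (fun x => (It τ).2 x.1) fun x => (hbound τ).2 x.1)
    rw [div_eq_mul_inv, ← hB] at h
    have hV : (learner m.γ β η Φ w (D :: H)).V = (It τ).2 := rfl
    rw [hV]
    have h2 : avg dπ (fun x => (It τ).2 x.1) - avg (sampleOccupancy m
        (learnerPolicy m.γ β η Φ w (D :: H))) (fun x => (It τ).2 x.1) ≤ B * (4 * η * B) * B := h.2
    linarith
  have hcmp : B * (4 * η * B) + B * (4 * η * B) * B ≤ 8 * η * B ^ 3 := by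
    have h1 : 0 ≤ 4 * η * B ^ 2 * (B - 1) :=
      mul_nonneg (by positivity) (by linarith)
    nlinarith
  have hV0 : (It 0).2 = (learner m.γ β η Φ w H).V := rfl
  have hQ0 : (It 0).1 = (learner m.γ β η Φ w H).Q := rfl
  rw [hV0, hQ0, hbonus] at hsum
  have hQτ : (learner m.γ β η Φ w (D :: H)).Q = (It τ).1 := rfl
  simp only [potential, hQτ]
  linarith

theorem regretSum_eq (π' : Policy S A) (K : ℕ) (H : List (Batch S A τ)) :
    regretSum m β η Φ w π' K H = ∑ k ∈ Finset.range K,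
      (avg (sampleOccupancy m (learnerPolicy m.γ β η Φ w (H.rtake (k / τ))))
        (linCost Φ (w k (H.rtake (k / τ + 1)))) -
      avg (sampleOccupancy m π') (linCost Φ (w k (H.rtake (k / τ + 1))))) := by
  refine Finset.sum_congr rfl fun k _ => ?_
  simp only [sub_mul, Finset.sum_sub_distrib, sum_occupancy_mul]

/-- Costs lie in `[-1, 1]`, so an episode contributes at most 2. This handles the incomplete last
batch and gives the trivial bound `2K`. -/
theorem regretSum_le_add {Φ : Features S A d} (hΦ : ∀ x, ∑ i, |Φ x i| ≤ 1) (π' : Policy S A)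
    {K : ℕ} (hw : ∀ k < K, ∀ H, ‖w k H‖ ≤ 1) (n r : ℕ) (hK : n + r ≤ K)
    (H : List (Batch S A τ)) :
    regretSum m β η Φ w π' (n + r) H ≤ regretSum m β η Φ w π' n H + 2 * r := by
  rw [regretSum_eq, regretSum_eq, Finset.sum_range_add]
  refine add_le_add le_rfl ?_
  calc _ ≤ ∑ _k ∈ Finset.range r, (2 : ℝ) := by
        refine Finset.sum_le_sum fun k hk => ?_
        rw [Finset.mem_range] at hk
        have h := abs_linCost_le hΦ (hw (n + k) (by omega) (H.rtake ((n + k) / τ + 1)))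
        have h1 := abs_le.mp (abs_avg_le
          (sampleOccupancy m (learnerPolicy m.γ β η Φ w (H.rtake ((n + k) / τ)))) h)
        have h2 := abs_le.mp (abs_avg_le (sampleOccupancy m π') h)
        linarith
    _ = 2 * r := by simp [mul_comm]

theorem regretSum_le_two_mul {Φ : Features S A d} (hΦ : ∀ x, ∑ i, |Φ x i| ≤ 1)
    (π' : Policy S A) {K : ℕ} (hw : ∀ k < K, ∀ H, ‖w k H‖ ≤ 1) (H : List (Batch S A τ)) :
    regretSum m β η Φ w π' K H ≤ 2 * K := by
  have h := regretSum_le_add m β η w hΦ π' hw 0 K (by omega) H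
  have h0 : regretSum m β η Φ w π' 0 H = 0 := rfl
  rw [zero_add, h0, zero_add] at h
  exact h

/-- Earlier episodes read only the oldest entries of the list, which a new head does not affect. -/
theorem regretSum_cons (hτ : 0 < τ) (π' : Policy S A) (D : Batch S A τ)
    (H : List (Batch S A τ)) :
    regretSum m β η Φ w π' ((D :: H).length * τ) (D :: H) =
      regretSum m β η Φ w π' (H.length * τ) H + ∑ n ∈ Finset.range τ,
        (avg (sampleOccupancy m (learnerPolicy m.γ β η Φ w H))
          (linCost Φ (w (H.length * τ + n) (D :: H))) -
        avg (sampleOccupancy m π') (linCost Φ (w (H.length * τ + n) (D :: H)))) := by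
  rw [regretSum_eq, regretSum_eq, List.length_cons, Nat.succ_mul, Finset.sum_range_add]
  congr 1
  · refine Finset.sum_congr rfl fun k hk => ?_
    have h1 : k / τ < H.length := (Nat.div_lt_iff_lt_mul hτ).mpr (Finset.mem_range.mp hk)
    rw [rtake_cons_of_le D H h1.le, rtake_cons_of_le D H h1]
  · refine Finset.sum_congr rfl fun n hn => ?_
    have h1 : (H.length * τ + n) / τ = H.length := by
      rw [mul_comm, Nat.mul_add_div hτ, Nat.div_eq_of_lt (Finset.mem_range.mp hn), add_zero]
    rw [h1, rtake_cons_of_le D H le_rfl, rtake_of_length_le H le_rfl,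
      rtake_of_length_le (D :: H) (List.length_cons ..).le]

/-- The regret of all complete batches on the good event. -/
theorem regretSum_le_potential {m : MDP S A} {Φ : Features S A d}
    (hΦ : ∀ x, ∑ i, |Φ x i| ≤ 1) {β η : ℝ} (hη : 0 < η) (hτ : 0 < τ)
    {w : Adversary S A d τ} (π' : Policy S A) (H : List (Batch S A τ))
    (hw : ∀ k < H.length * τ, ∀ H, ‖w k H‖ ≤ 1) (hgood : goodHistory m Φ β η w H) :
    regretSum m β η Φ w π' (H.length * τ) H ≤
      potential m Φ β η w π' H - potential m Φ β η w π' [] +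
        2 * τ * β * sumWidth m Φ β η w H +
        H.length * (τ * η * (1 - m.γ)⁻¹ ^ 2 / 2 + 8 * η * (1 - m.γ)⁻¹ ^ 3) := by
  induction H with
  | nil =>
    have h0 : regretSum m β η Φ w π' (([] : List (Batch S A τ)).length * τ) [] = 0 := by
      rw [List.length_nil, zero_mul]
      rfl
    rw [h0]
    simp [sumWidth]
  | cons D H ih =>
    have hlen : (D :: H).length * τ = H.length * τ + τ := by
      rw [List.length_cons, Nat.succ_mul]
    have h1 := ih (fun k hk => hw k (by omega)) hgood.2
    have h2 := batch_regret_le hΦ hη hτ π' (D := D) (H := H)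
      (fun n hn => hw _ (by omega) _) hgood.1
    rw [regretSum_cons m Φ β η w hτ]
    simp only [sumWidth, List.length_cons]
    push_cast
    linarith

/-- The regret on the good event. -/
theorem regretSum_le_of_goodHistory {m : MDP S A} {Φ : Features S A d}
    (hΦ : ∀ x, ∑ i, |Φ x i| ≤ 1) {β η : ℝ} (hη : 0 < η) (hτ : 0 < τ)
    {w : Adversary S A d τ} (π' : Policy S A) {K : ℕ} (hw : ∀ k < K, ∀ H, ‖w k H‖ ≤ 1)
    (H : List (Batch S A τ)) (hH : H.length = K / τ) (hgood : goodHistory m Φ β η w H) :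
    regretSum m β η Φ w π' K H ≤ 2 * (1 - m.γ)⁻¹ + τ * Real.log (Fintype.card A) / η +
        2 * τ * β * sumWidth m Φ β η w H +
        K / τ * (τ * η * (1 - m.γ)⁻¹ ^ 2 / 2 + 8 * η * (1 - m.γ)⁻¹ ^ 3) + 2 * τ := by
  have hB := zero_le_one.trans (one_le_inv_one_sub m)
  have hK : H.length * τ + K % τ = K := by
    rw [hH, mul_comm]
    exact Nat.div_add_mod K τ
  have h1 := regretSum_le_add m β η w hΦ π' hw (H.length * τ) (K % τ) hK.le H
  rw [hK] at h1
  have h2 := regretSum_le_potential hΦ hη hτ π' H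
    (fun k hk => hw k (by omega)) hgood
  have h3 := potential_le m Φ β η w hη π' H
  rw [potential_nil] at h2
  have h4 : ((K % τ : ℕ) : ℝ) ≤ τ := Nat.cast_le.mpr (Nat.mod_lt K hτ).le
  have h5 : (H.length : ℝ) ≤ K / τ := by
    rw [hH]
    exact Nat.cast_div_le
  have h6 := mul_le_mul_of_nonneg_right h5 (by positivity :
    0 ≤ τ * η * (1 - m.γ)⁻¹ ^ 2 / 2 + 8 * η * (1 - m.γ)⁻¹ ^ 3)
  linarith

end Regret

/-! ### Probability of the good event -/

section GoodEvent

open Matrix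

variable {S A : Type*} [Fintype S] [Fintype A] [Nonempty A] {d τ : ℕ}

omit [Fintype A] in
-- For `d = 0` the product `ΦM` vanishes, contradicting that transition probabilities sum to one.
theorem dim_pos_of_isLinear {m : MDP S A} {Φ : Features S A d} (hlin : IsLinear m Φ) : 0 < d := by
  rcases Nat.eq_zero_or_pos d with rfl | h
  · obtain ⟨-, M, -, hP⟩ := hlin
    obtain ⟨s, -⟩ := m.ν₀.support_nonempty
    have h1 := sum_toReal_eq_one (m.P s (Classical.arbitrary A))
    simp [hP, Matrix.mul_apply] at h1
  · exact h

omit [Fintype S] in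
theorem length_of_mem_support_historyLaw {m : MDP S A} {Φ : Features S A d} {β η : ℝ}
    {w : Adversary S A d τ} {n : ℕ} {H : List (Batch S A τ)}
    (hH : H ∈ (historyLaw m β η Φ w n).support) : H.length = n := by
  induction n generalizing H with
  | zero =>
    rw [historyLaw, PMF.support_pure, Set.mem_singleton_iff] at hH
    rw [hH, List.length_nil]
  | succ n ih =>
    rw [historyLaw, PMF.mem_support_bind_iff] at hH
    obtain ⟨H', hH', h⟩ := hH
    rw [PMF.mem_support_map_iff] at h
    obtain ⟨D, -, rfl⟩ := h
    rw [List.length_cons, ih hH']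

omit [Fintype S] in
theorem ex_historyLaw_succ (m : MDP S A) (Φ : Features S A d) (β η : ℝ) (w : Adversary S A d τ)
    (n : ℕ) (f : List (Batch S A τ) → ℝ≥0∞) :
    ex (historyLaw m β η Φ w (n + 1)) f = ex (historyLaw m β η Φ w n) fun H =>
      ex (iid (sampleTransition m (learnerPolicy m.γ β η Φ w H)) τ) fun D => f (D :: H) := by
  rw [historyLaw, ex_bind]
  simp only [ex_map]

/-- The number of batches in which some regression error exceeds the bonus. -/
def badCount (m : MDP S A) (Φ : Features S A d) (β η : ℝ) (w : Adversary S A d τ) :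
    List (Batch S A τ) → ℝ≥0∞
  | [] => 0
  | D :: H => {D | ¬goodBatch m Φ β η w D H}.indicator (fun _ => 1) D + badCount m Φ β η w H

theorem one_le_badCount {m : MDP S A} {Φ : Features S A d} {β η : ℝ} {w : Adversary S A d τ}
    {H : List (Batch S A τ)} (h : ¬goodHistory m Φ β η w H) : 1 ≤ badCount m Φ β η w H := by
  induction H with
  | nil => exact absurd trivial h
  | cons D H ih =>
    rw [badCount]
    by_cases hD : goodBatch m Φ β η w D H
    · exact (ih fun hH => h ⟨hD, hH⟩).trans le_add_self
    · rw [Set.indicator_of_mem (show D ∈ {D | ¬goodBatch m Φ β η w D H} from hD)]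
      exact le_self_add

/-- A union bound over batches, with the failure probability of each controlled conditionally on the
past; the costs may still depend on the new dataset. -/
theorem ex_badCount_le {m : MDP S A} {Φ : Features S A d} {β η : ℝ} {w : Adversary S A d τ}
    {J : ℕ} {ε : ℝ}
    (hbad : ∀ H : List (Batch S A τ), H.length < J →
      avg (iid (sampleTransition m (learnerPolicy m.γ β η Φ w H)) τ)
        ({D | ¬goodBatch m Φ β η w D H}.indicator fun _ => 1) ≤ ε) (n : ℕ) (hn : n ≤ J) :
    ex (historyLaw m β η Φ w n) (badCount m Φ β η w) ≤ n * ENNReal.ofReal ε := by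
  induction n with
  | zero => simp [historyLaw, ex_pure, badCount]
  | succ n ih =>
    rw [ex_historyLaw_succ]
    calc _ ≤ ex (historyLaw m β η Φ w n) fun H => ENNReal.ofReal ε + badCount m Φ β η w H := by
          refine ex_mono_on_support _ fun H hH => ?_
          simp only [badCount, ex_add, ex_const]
          refine add_le_add ?_ le_rfl
          have h1 := hbad H (by rw [length_of_mem_support_historyLaw hH]; omega)
          refine le_trans (le_of_eq ?_) (ENNReal.ofReal_le_ofReal h1)
          rw [← ex_ofReal]
          · refine congrArg _ (funext fun D => ?_)
            by_cases hD : D ∈ {D | ¬goodBatch m Φ β η w D H} <;> simp [hD]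
          · exact fun D => Set.indicator_nonneg (fun _ _ => zero_le_one) D
      _ = ENNReal.ofReal ε + ex (historyLaw m β η Φ w n) (badCount m Φ β η w) := by
          rw [ex_add, ex_const]
      _ ≤ ENNReal.ofReal ε + n * ENNReal.ofReal ε := add_le_add le_rfl (ih (by omega))
      _ = _ := by
          push_cast
          ring

theorem batchWidth_mem_Icc {Φ : Features S A d} (hΦ : ∀ x, ∑ i, |Φ x i| ≤ 1) (m : MDP S A)
    (β η : ℝ) (w : Adversary S A d τ) (D : Batch S A τ) (H : List (Batch S A τ)) :
    0 ≤ batchWidth m Φ β η w D H ∧ batchWidth m Φ β η w D H ≤ 1 := by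
  refine ⟨avg_nonneg _ fun x => Real.sqrt_nonneg _, ?_⟩
  rw [← avg_const (sampleOccupancy m (learnerPolicy m.γ β η Φ w H)) 1]
  exact avg_mono _ fun x => Real.sqrt_le_one.mpr
    ((invSq_le Φ D _).trans (dotProduct_self_le_one_of_sum_abs (hΦ x)))

/-- The exponentials form a supermartingale: a width lies in `[0, 1]`, where `exp y ≤ 1 + 2y`, and
has conditional mean at most `r`, which the compensator `2r` absorbs. -/
theorem ex_exp_sumWidth_le {m : MDP S A} {Φ : Features S A d} (hlin : IsLinear m Φ) (hτ : 0 < τ)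
    (β η : ℝ) (w : Adversary S A d τ) (n : ℕ) :
    ex (historyLaw m β η Φ w n) (fun H =>
      ENNReal.ofReal (Real.exp (sumWidth m Φ β η w H - n * (2 * √(2 * d / τ))))) ≤ 1 := by
  set r := √(2 * d / τ)
  induction n with
  | zero => simp [historyLaw, ex_pure, sumWidth]
  | succ n ih =>
    rw [ex_historyLaw_succ]
    refine le_trans (ex_mono _ fun H => ?_) ih
    set p := iid (sampleTransition m (learnerPolicy m.γ β η Φ w H)) τ
    rw [ex_ofReal _ fun _ => (Real.exp_pos _).le]
    refine ENNReal.ofReal_le_ofReal ?_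
    have h1 : avg p (fun D => Real.exp (batchWidth m Φ β η w D H)) ≤ Real.exp (2 * r) := by
      calc avg p (fun D => Real.exp (batchWidth m Φ β η w D H))
          ≤ avg p fun D => 1 + 2 * batchWidth m Φ β η w D H := by
            refine avg_mono _ fun D => ?_
            obtain ⟨h0, h1⟩ := batchWidth_mem_Icc hlin.1 m β η w D H
            have h2 := (abs_le.mp (Real.abs_exp_sub_one_sub_id_le
              (abs_le.mpr ⟨by linarith, h1⟩))).2
            nlinarith
        _ = 1 + 2 * avg p fun D => batchWidth m Φ β η w D H := by
            rw [avg_add, avg_const, avg_const_mul]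
        _ ≤ 1 + 2 * r := by
            have := avg_iid_sqrt_invSq_le m Φ (dim_pos_of_isLinear hlin) hlin.1
              (learnerPolicy m.γ β η Φ w H) hτ
            exact add_le_add le_rfl (mul_le_mul_of_nonneg_left this zero_le_two)
        _ ≤ Real.exp (2 * r) := by linarith [Real.add_one_le_exp (2 * r)]
    calc avg p (fun D => Real.exp (sumWidth m Φ β η w (D :: H) - (n + 1 : ℕ) * (2 * r)))
        = Real.exp (sumWidth m Φ β η w H - n * (2 * r)) * Real.exp (-(2 * r)) *
            avg p fun D => Real.exp (batchWidth m Φ β η w D H) := by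
          rw [← avg_const_mul]
          refine congrArg _ (funext fun D => ?_)
          rw [← Real.exp_add, ← Real.exp_add, sumWidth]
          congr 1
          push_cast
          ring
      _ ≤ Real.exp (sumWidth m Φ β η w H - n * (2 * r)) * Real.exp (-(2 * r)) *
            Real.exp (2 * r) := mul_le_mul_of_nonneg_left h1 (by positivity)
      _ = _ := by rw [mul_assoc, ← Real.exp_add, neg_add_cancel, Real.exp_zero, mul_one]

omit [Fintype S] in
-- The adaptive cost and the regression vector enter only through the sum `θ = w + γv`. Hence
-- covering a box of `θ` covers every adversary.
theorem batchIter_eq_candidateValue (m : MDP S A) (Φ : Features S A d) (β η : ℝ)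
    (w : Adversary S A d τ) (D : Batch S A τ) (H : List (Batch S A τ)) (n : ℕ) :
    (batchIter m Φ β η w D H (n + 1)).2 =
      candidateValue (1 - m.γ)⁻¹ β Φ (learnerPolicy m.γ β η Φ w H)
        (fun i => w (H.length * τ + n) (D :: H) i +
          m.γ * regress Φ D (batchIter m Φ β η w D H n).2 i) (covariance Φ D)⁻¹ := by
  funext s
  rw [batchIter_succ_snd, candidateValue]
  refine congrArg _ (funext fun a => ?_)
  rw [batchIter_succ]
  change clip _ _ = clip _ _
  congr 1
  rw [bonus]
  congr 1
  simp only [linCost, dotProduct, mul_add, Finset.sum_add_distrib, Finset.mul_sum]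
  congr 1
  exact Finset.sum_congr rfl fun i _ => by ring

theorem avg_indicator_not_goodBatch_le {m : MDP S A} {Φ : Features S A d} (hlin : IsLinear m Φ)
    (hτ : 0 < τ) {w : Adversary S A d τ} {K : ℕ} (hw : ∀ k < K, ∀ H, ‖w k H‖ ≤ 1)
    {β h L : ℝ} (η : ℝ) {N : ℕ} (hβ : 0 < β) (hh : 0 < h)
    (hβR : β / (2 * (1 - m.γ)⁻¹ ^ 2) ≤ 2 * τ * (1 - m.γ)⁻¹)
    (hN : 2 * τ * (1 - m.γ)⁻¹ / h ≤ N)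
    (hdB : 2 * √d * (1 - m.γ)⁻¹ ≤ β)
    (hL : L + τ * (2 * (β / (2 * (1 - m.γ)⁻¹ ^ 2)) * (h + β * √h) + 2 * (1 - m.γ)⁻¹ * h +
      (1 - m.γ)⁻¹ ^ 2 * h * (2 * (β / (2 * (1 - m.γ)⁻¹ ^ 2)) + h) / 2) ≤
      β ^ 2 / (8 * (1 - m.γ)⁻¹ ^ 2))
    (H : List (Batch S A τ)) (hH : H.length < K / τ) :
    avg (iid (sampleTransition m (learnerPolicy m.γ β η Φ w H)) τ)
        ({D | ¬goodBatch m Φ β η w D H}.indicator fun _ => 1) ≤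
      Real.exp (-L) * (2 * (2 * N + 1) ^ (2 * d + d ^ 2)) := by
  have hB1 := one_le_inv_one_sub m
  have hτ1 : (1 : ℝ) ≤ τ := Nat.one_le_cast.mpr hτ
  have hHK : H.length * τ + τ ≤ K := by
    have h1 := Nat.mul_le_mul_right τ hH
    have h2 := Nat.div_mul_le_self K τ
    rw [Nat.succ_mul] at h1
    omega
  refine avg_indicator_regress_le hlin _ (V₀ := (learner m.γ β η Φ w H).V)
    (by linarith) hβ hh (learner_bound m Φ β η w H).2 (by nlinarith) hβR hN hdB hL _ ?_
  intro D hD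
  simp only [Set.mem_ofPred_eq, goodBatch, not_forall, not_le] at hD
  obtain ⟨n, hn, x, hx⟩ := hD
  refine ⟨_, ?_, x, hx⟩
  cases n with
  | zero => exact Or.inl rfl
  | succ n =>
    -- The coordinates satisfy `|θᵢ| ≤ 1 + τB ≤ 2τB`, the side of the box.
    refine Or.inr ⟨_, fun i => ?_, batchIter_eq_candidateValue m Φ β η w D H n⟩
    have h1 := abs_regress_le Φ D hlin.1 (batchIter_bound m Φ β η w D H n).2 i
    have h2 : |w (H.length * τ + n) (D :: H) i| ≤ 1 :=
      (PiLp.norm_apply_le _ i).trans (hw _ (by omega) _)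
    refine (abs_add_le _ _).trans ?_
    rw [abs_mul, abs_of_nonneg m.γ_nonneg]
    have h3 : m.γ * |regress Φ D (batchIter m Φ β η w D H n).2 i| ≤ 1 * (τ * (1 - m.γ)⁻¹) :=
      mul_le_mul m.γ_lt_one.le h1 (abs_nonneg _) zero_le_one
    nlinarith

end GoodEvent

/-! ### Numerical estimates -/

section Numerics

/-- With this mesh `√h = τ⁻²B⁻¹`, so the square-root term is `β²/(τB³)`. It is bounded because `β² ≤
τ`; the other terms carry higher powers of `τ⁻¹`. -/
theorem discretization_error_le {τ B β : ℝ} (hτ : 1 ≤ τ) (hB : 1 ≤ B) (hβ : 0 < β)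
    (hβτ : β ^ 2 ≤ τ) {h : ℝ} (hh : h = (τ ^ 4 * B ^ 2)⁻¹) :
    τ * (2 * (β / (2 * B ^ 2)) * (h + β * √h) + 2 * B * h +
      B ^ 2 * h * (2 * (β / (2 * B ^ 2)) + h) / 2) ≤ 5 := by
  obtain ⟨a, ha⟩ : ∃ a, a = τ⁻¹ := ⟨_, rfl⟩
  obtain ⟨b, hb⟩ : ∃ b, b = B⁻¹ := ⟨_, rfl⟩
  have hτ0 : 0 < τ := by linarith
  have hB0 : 0 < B := by linarith
  have ha0 : 0 < a := ha ▸ inv_pos.mpr hτ0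
  have hb0 : 0 < b := hb ▸ inv_pos.mpr hB0
  have ha1 : a ≤ 1 := ha ▸ inv_le_one_of_one_le₀ hτ
  have hb1 : b ≤ 1 := hb ▸ inv_le_one_of_one_le₀ hB
  have hτa : τ * a = 1 := by rw [ha, mul_inv_cancel₀ hτ0.ne']
  have hβτ' : β ≤ τ := by nlinarith
  have hβa : β * a ≤ 1 := by
    rw [← hτa]
    exact mul_le_mul_of_nonneg_right hβτ' ha0.le
  have hβ2a : β ^ 2 * a ≤ 1 := by
    rw [← hτa]
    exact mul_le_mul_of_nonneg_right hβτ ha0.le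
  have hs : √h = a ^ 2 * b := by
    rw [hh, show (τ ^ 4 * B ^ 2)⁻¹ = (a ^ 2 * b) ^ 2 by rw [ha, hb]; field_simp]
    exact Real.sqrt_sq (by positivity)
  have hh' : h = a ^ 4 * b ^ 2 := by rw [hh, ha, hb]; field_simp
  have e : τ * (2 * (β / (2 * B ^ 2)) * (h + β * √h) + 2 * B * h +
      B ^ 2 * h * (2 * (β / (2 * B ^ 2)) + h) / 2) =
      (β * a) * (a ^ 2 * b ^ 4) + (β ^ 2 * a) * b ^ 3 + 2 * (a ^ 3 * b) +
        ((β * a) * (a ^ 2 * b ^ 2) + a ^ 7 * b ^ 2) / 2 := by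
    rw [hs, hh', show τ = a⁻¹ by rw [ha, inv_inv], show B = b⁻¹ by rw [hb, inv_inv]]
    field_simp
  have hp : ∀ n k : ℕ, a ^ n * b ^ k ≤ 1 := fun n k =>
    mul_le_one₀ (pow_le_one₀ ha0.le ha1) (by positivity) (pow_le_one₀ hb0.le hb1)
  have h1 := mul_le_one₀ hβa (by positivity) (hp 2 4)
  have h2 := mul_le_one₀ hβ2a (by positivity) (pow_le_one₀ hb0.le hb1 : b ^ 3 ≤ 1)
  have h3 := hp 3 1
  have h4 := mul_le_one₀ hβa (by positivity) (hp 2 2)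
  have h5 := hp 7 2
  rw [pow_one] at h3
  rw [e]
  linarith

theorem exists_discretization {τ d J K : ℕ} (hτ : 0 < τ) (hd : 0 < d) (hJ : 0 < J) (hJK : J ≤ K)
    {B β δ l : ℝ} (hB : 1 ≤ B) (hβ : 0 < β) (hβτ : β ^ 2 ≤ τ) (hδ : 0 < δ)
    (hl2 : Real.log 2 ≤ l) (hlτ : Real.log τ ≤ l) (hlB : Real.log B ≤ l)
    (hlK : Real.log (K / δ) ≤ l) (hβl : 100 * (d * B * l) ≤ β) :
    ∃ (h L : ℝ) (N : ℕ), 0 < h ∧ 2 * τ * B / h ≤ N ∧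
      L + τ * (2 * (β / (2 * B ^ 2)) * (h + β * √h) + 2 * B * h +
        B ^ 2 * h * (2 * (β / (2 * B ^ 2)) + h) / 2) ≤ β ^ 2 / (8 * B ^ 2) ∧
      Real.exp (-L) * (2 * (2 * N + 1) ^ (2 * d + d ^ 2)) ≤ δ / J := by
  have hτ1 : (1 : ℝ) ≤ τ := Nat.one_le_cast.mpr hτ
  have hd1 : (1 : ℝ) ≤ d := Nat.one_le_cast.mpr hd
  have hJ1 : (1 : ℝ) ≤ J := Nat.one_le_cast.mpr hJ
  have hJK' : (J : ℝ) ≤ K := Nat.cast_le.mpr hJK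
  have hl0 : 0 < l := (Real.log_pos one_lt_two).trans_le hl2
  have hlog2 := Real.log_two_gt_d9
  set N := ⌈2 * (τ : ℝ) ^ 5 * B ^ 3⌉₊ with hN
  have hN1 : 2 * (τ : ℝ) ^ 5 * B ^ 3 ≤ N := Nat.le_ceil _
  have hN2 : (N : ℝ) < 2 * (τ : ℝ) ^ 5 * B ^ 3 + 1 := Nat.ceil_lt_add_one (by positivity)
  have hprod : 1 ≤ (τ : ℝ) ^ 5 * B ^ 3 := one_le_mul_of_one_le_of_one_le
    (one_le_pow₀ hτ1) (one_le_pow₀ hB)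
  have hside : (2 * (N : ℝ) + 1) ≤ 2 ^ 3 * (τ ^ 5 * B ^ 3) := by linarith
  have hside0 : 0 < 2 * (N : ℝ) + 1 := by positivity
  -- The count is `11 = 3 + 5 + 3`, from the powers of 2, `τ` and `B`.
  have hlogN : Real.log (2 * N + 1) ≤ 11 * l := by
    refine (Real.log_le_log hside0 hside).trans ?_
    rw [Real.log_mul (by positivity) (by positivity), Real.log_mul (by positivity) (by positivity),
      Real.log_pow, Real.log_pow, Real.log_pow]
    push_cast
    linarith
  have hlogJ : Real.log (2 * J / δ) ≤ 2 * l := by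
    have h1 : 2 * J / δ ≤ 2 * (K / δ) := by
      rw [mul_div_assoc]
      exact mul_le_mul_of_nonneg_left (div_le_div_of_nonneg_right hJK' hδ.le) zero_le_two
    refine (Real.log_le_log (by positivity) h1).trans ?_
    rw [Real.log_mul two_ne_zero (div_pos (by linarith) hδ).ne']
    linarith
  -- `L` is the logarithm of the grid bound times `J/δ`, so the union bound is met with equality. It
  -- is at most `33d²l + 2l`, which with the error 5 stays below `(100dl)²/8` as `l ≥ log 2`.
  refine ⟨(τ ^ 4 * B ^ 2)⁻¹, (2 * d + d ^ 2 : ℕ) * Real.log (2 * N + 1) + Real.log (2 * J / δ),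
    N, by positivity, ?_, ?_, ?_⟩
  · refine le_trans (le_of_eq ?_) hN1
    field_simp
  · have h1 := discretization_error_le hτ1 hB hβ hβτ rfl
    have h2 : ((2 * d + d ^ 2 : ℕ) : ℝ) * Real.log (2 * N + 1) ≤ (3 * d ^ 2) * (11 * l) := by
      refine mul_le_mul ?_ hlogN (Real.log_nonneg (by linarith [Nat.cast_nonneg (α := ℝ) N]))
        (by positivity)
      push_cast
      nlinarith
    have h3 : (100 * (d * l)) ^ 2 / 8 ≤ β ^ 2 / (8 * B ^ 2) := by
      rw [div_le_div_iff₀ (by norm_num) (by positivity)]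
      have h4 : (100 * (d * B * l)) ^ 2 ≤ β ^ 2 := pow_le_pow_left₀ (by positivity) hβl 2
      nlinarith
    have h5 : l ≤ d ^ 2 * l := le_mul_of_one_le_left hl0.le (one_le_pow₀ hd1)
    have h6 : 0.69 * (d ^ 2 * l) ≤ l * (d ^ 2 * l) :=
      mul_le_mul_of_nonneg_right (by linarith) (by positivity)
    nlinarith
  · refine le_of_eq ?_
    rw [neg_add, Real.exp_add, Real.exp_neg, Real.exp_neg, Real.exp_log (by positivity),
      ← Real.log_pow, Real.exp_log (by positivity)]
    field_simp

end Numerics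

/-! ### The regret bound -/

section Main

variable {S A : Type*} [Fintype S] [Fintype A] [Nonempty A] {d τ : ℕ}

/-- From the two concentration events to a bound on the regret that holds with high
probability. -/
theorem le_probRegretLe_of_forall {m : MDP S A} {Φ : Features S A d} (hlin : IsLinear m Φ)
    (hτ : 0 < τ) {β η : ℝ} {w : Adversary S A d τ} (π' : Policy S A) {K : ℕ} {δ bound : ℝ}
    (hJ : 0 < K / τ) (hδ : 0 < δ)
    (hbad : ∀ H : List (Batch S A τ), H.length < K / τ →
      avg (iid (sampleTransition m (learnerPolicy m.γ β η Φ w H)) τ)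
        ({D | ¬goodBatch m Φ β η w D H}.indicator fun _ => 1) ≤ δ / (K / τ : ℕ))
    (hbound : ∀ H : List (Batch S A τ), H.length = K / τ → goodHistory m Φ β η w H →
      sumWidth m Φ β η w H ≤ (K / τ : ℕ) * (2 * √(2 * d / τ)) + Real.log (1 / δ) →
      regretSum m β η Φ w π' K H ≤ bound) :
    ENNReal.ofReal (1 - 2 * δ) ≤ probRegretLe m β η Φ w π' K bound := by
  have hJ' : (0 : ℝ) < (K / τ : ℕ) := Nat.cast_pos.mpr hJ
  rw [probRegretLe, toOuterMeasure_eq_ex]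
  set p := historyLaw m β η Φ w (K / τ) with hp
  set good := {H | regretSum m β η Φ w π' K H ≤ bound}
  have h1 : ex p (badCount m Φ β η w) ≤ ENNReal.ofReal δ := by
    refine (ex_badCount_le hbad (K / τ) le_rfl).trans (le_of_eq ?_)
    rw [← ENNReal.ofReal_natCast, ← ENNReal.ofReal_mul hJ'.le, mul_div_cancel₀ _ hJ'.ne']
  have h2 := ex_exp_sumWidth_le hlin hτ β η w (K / τ)
  rw [← hp] at h2
  -- Pointwise, a history has small regret, or contains a bad batch, or has so large a total width
  -- that `δ` times the exponential is at least one. Taking expectations performs the union bound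
  -- and Markov's inequality together.
  have h3 : (1 : ℝ≥0∞) ≤ ex p (good.indicator fun _ => 1) + ex p (badCount m Φ β η w) +
      ENNReal.ofReal δ * ex p (fun H => ENNReal.ofReal (Real.exp (sumWidth m Φ β η w H -
        (K / τ : ℕ) * (2 * √(2 * d / τ))))) := by
    rw [← ex_const_mul, ← ex_add, ← ex_add]
    refine (ex_const p 1).symm.le.trans (ex_mono_on_support p fun H hH => ?_)
    by_cases hgood : H ∈ good
    · rw [Set.indicator_of_mem hgood, add_assoc]
      exact le_self_add
    by_cases hhist : goodHistory m Φ β η w H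
    · refine le_trans ?_ le_add_self
      have h4 : (K / τ : ℕ) * (2 * √(2 * d / τ)) + Real.log (1 / δ) < sumWidth m Φ β η w H := by
        by_contra! hc
        exact hgood (hbound H (length_of_mem_support_historyLaw hH) hhist hc)
      rw [← ENNReal.ofReal_mul hδ.le, ENNReal.one_le_ofReal]
      calc (1 : ℝ) = δ * Real.exp (Real.log (1 / δ)) := by
            rw [Real.exp_log (by positivity), mul_one_div_cancel hδ.ne']
        _ ≤ _ := mul_le_mul_of_nonneg_left (Real.exp_le_exp.mpr (by linarith)) hδ.le
    · exact (one_le_badCount hhist).trans (le_add_self.trans le_self_add)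
  have h5 : (1 : ℝ≥0∞) ≤ ex p (good.indicator fun _ => 1) + ENNReal.ofReal (2 * δ) := by
    refine h3.trans ?_
    rw [add_assoc, two_mul δ, ENNReal.ofReal_add hδ.le hδ.le]
    refine add_le_add le_rfl (add_le_add h1 ?_)
    exact (mul_le_mul_right h2 _).trans_eq (mul_one _)
  rw [ENNReal.ofReal_sub _ (by linarith), ENNReal.ofReal_one]
  exact tsub_le_iff_right.mpr h5

/-- The regret bound for every admissible choice of the parameters. -/
theorem le_probRegretLe_regretBound {m : MDP S A} {Φ : Features S A d} (hlin : IsLinear m Φ)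
    {K : ℕ} {δ : ℝ} (hK : 0 < K) (hδ : 0 < δ) (hτ : 0 < τ)
    (hτK : (τ : ℝ) ≤ K / √τ) {η : ℝ} (hη : 0 < η) {β : ℝ}
    (hβ : 100 * explorationScale d K τ m.γ δ ≤ β) {w : Adversary S A d τ}
    (hw : ∀ k < K, ∀ H, ‖w k H‖ ≤ 1) (π' : Policy S A) :
    ENNReal.ofReal (1 - 2 * δ) ≤
      probRegretLe m β η Φ w π' K (regretBound d (Fintype.card A) K τ m.γ β η δ) := by
  rcases le_or_gt (1 / 2) δ with hδ2 | hδ2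
  · rw [ENNReal.ofReal_of_nonpos (by linarith)]
    exact zero_le
  have hd := dim_pos_of_isLinear hlin
  have hτ1 : (1 : ℝ) ≤ τ := Nat.one_le_cast.mpr hτ
  have hd1 : (1 : ℝ) ≤ d := Nat.one_le_cast.mpr hd
  have hK1 : (1 : ℝ) ≤ K := Nat.one_le_cast.mpr hK
  have hsτ : 1 ≤ √(τ : ℝ) := Real.one_le_sqrt.mpr hτ1
  have hsd : 1 ≤ √(d : ℝ) := Real.one_le_sqrt.mpr hd1
  have hτK' : (τ : ℝ) ≤ K := hτK.trans (div_le_self (by linarith) hsτ)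
  have hJ : 0 < K / τ := Nat.div_pos (Nat.cast_le.mp hτK') hτ
  have hlog2 := Real.log_two_gt_d9
  set B := (1 - m.γ)⁻¹ with hBdef
  have hB1 : 1 ≤ B := one_le_inv_one_sub m
  have hγ : 0 < 1 - m.γ := by linarith [m.γ_lt_one]
  -- the logarithm in the exploration scale
  set X := τ * K * √d / (δ * (1 - m.γ)) * d / (1 - m.γ) with hX
  have hXeq : X = (τ * √d * d * B ^ 2) * (K / δ) := by
    rw [hX, hBdef]
    field_simp
  have hKδ : 2 ≤ K / δ := by
    rw [le_div_iff₀ hδ]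
    linarith
  have hτdB : 1 ≤ τ * √d * d := one_le_mul_of_one_le_of_one_le
    (one_le_mul_of_one_le_of_one_le hτ1 hsd) hd1
  have hB2 : 1 ≤ B ^ 2 := one_le_pow₀ hB1
  have hXK : K / δ ≤ X := by
    rw [hXeq]
    exact le_mul_of_one_le_left (by linarith) (one_le_mul_of_one_le_of_one_le hτdB hB2)
  have hXτ : τ ≤ X := by
    rw [hXeq]
    have h1 : (τ : ℝ) ≤ τ * √d * d * B ^ 2 := by
      rw [mul_assoc, mul_assoc]
      exact le_mul_of_one_le_right (by linarith) (one_le_mul_of_one_le_of_one_le hsd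
        (one_le_mul_of_one_le_of_one_le hd1 hB2))
    exact h1.trans (le_mul_of_one_le_right (by linarith) (by linarith))
  have hXB : B ≤ X := by
    rw [hXeq]
    have h1 : B ≤ τ * √d * d * B ^ 2 :=
      (le_self_pow₀ hB1 two_ne_zero).trans (le_mul_of_one_le_left (by positivity) hτdB)
    exact h1.trans (le_mul_of_one_le_right (by linarith) (by linarith))
  set l := Real.log X with hl
  have hl2 : Real.log 2 ≤ l := Real.log_le_log two_pos (hKδ.trans hXK)
  have hβl : 100 * (d * B * l) ≤ β := by
    refine le_trans (le_of_eq ?_) hβ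
    rw [explorationScale, ← hX, ← hl, div_eq_mul_inv]
  have hβB : 69 * B ≤ β := by
    have h1 : B * 0.69 ≤ d * B * l := by
      refine mul_le_mul (le_mul_of_one_le_left (by linarith) hd1) (by linarith) (by norm_num)
        (by positivity)
    linarith
  have hβ0 : 0 < β := by linarith
  -- the logarithm in the regret bound
  set ℓ := Real.log (2 * K * d / (τ * δ)) with hℓdef
  have hℓ1 : Real.log 2 + Real.log (1 / δ) ≤ ℓ := by
    rw [← Real.log_mul two_ne_zero (by positivity)]
    refine Real.log_le_log (by positivity) ?_
    rw [mul_one_div, div_le_div_iff₀ hδ (by positivity)]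
    have : (τ : ℝ) ≤ K * d := hτK'.trans (le_mul_of_one_le_right (by linarith) hd1)
    linarith [mul_le_mul_of_nonneg_right this hδ.le]
  have hδlog : Real.log 2 ≤ Real.log (1 / δ) := by
    refine Real.log_le_log two_pos ?_
    rw [le_div_iff₀ hδ]
    linarith
  have hℓ : 1.38 ≤ ℓ := by linarith
  have hlogA : 0 ≤ Real.log (Fintype.card A) := Real.log_natCast_nonneg _
  set q := √((d : ℝ) / τ) with hq
  have hq0 : 0 < q := Real.sqrt_pos.mpr (by positivity)
  have hq2 : q ^ 2 = d / τ := Real.sq_sqrt (by positivity)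
  have hlast : 0 ≤ √(2 * η) * K / ((1 - m.γ) ^ 2 * τ) := by positivity
  have hBsq : η * K / (1 - m.γ) ^ 2 = η * K * B ^ 2 := by
    rw [hBdef]
    field_simp
  have hmid : 0 ≤ (τ + 1) / (1 - m.γ) := by positivity
  have hfirst : 0 ≤ τ * Real.log (Fintype.card A) / η := by positivity
  -- In the first case the fourth term of the bound alone is at least `2K`. In the second, `ℓ ≥ 1`
  -- gives `6βq ≤ 1`, so `τ ≥ 36β²` and in particular `τ ≥ 16B`.
  rcases le_or_gt 2 (12 * β * q * ℓ) with hbig | hsmall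
  · have hall : ∀ H, regretSum m β η Φ w π' K H ≤
        regretBound d (Fintype.card A) K τ m.γ β η δ := by
      intro H
      refine (regretSum_le_two_mul m β η w hlin.1 π' hw H).trans ?_
      have h1 := mul_le_mul_of_nonneg_right hbig (by linarith : (0 : ℝ) ≤ K)
      have h2 : 0 ≤ η * K / (1 - m.γ) ^ 2 := by positivity
      rw [regretBound, ← hq, ← hℓdef]
      linarith
    rw [probRegretLe, toOuterMeasure_eq_ex]
    refine le_trans (b := 1) ?_ ?_
    · rw [ENNReal.ofReal_le_one]
      linarith
    · refine (ex_const _ 1).symm.le.trans (ex_mono _ fun H => ?_)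
      have hH : H ∈ {H | regretSum m β η Φ w π' K H ≤
        regretBound d (Fintype.card A) K τ m.γ β η δ} := hall H
      rw [Set.indicator_of_mem hH]
  have hβq : 6 * (β * q) ≤ 1 := by
    have h0 := mul_le_mul_of_nonneg_left (by linarith : 1 ≤ ℓ) (mul_pos hβ0 hq0).le
    linarith
  have hβτ : 36 * β ^ 2 ≤ τ := by
    have h1 : (6 * (β * q)) ^ 2 ≤ 1 := pow_le_one₀ (by positivity) hβq
    rw [mul_pow, mul_pow, hq2] at h1
    have h2 : β ^ 2 * (1 / τ) ≤ β ^ 2 * (d / τ) :=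
      mul_le_mul_of_nonneg_left (div_le_div_of_nonneg_right hd1 (by linarith)) (by positivity)
    have h3 : 36 * β ^ 2 * (1 / τ) ≤ 1 := by linarith
    rwa [mul_one_div, div_le_one (by linarith)] at h3
  have hββ : β ≤ β ^ 2 := le_self_pow₀ (by linarith) two_ne_zero
  have hβτ' : β ^ 2 ≤ τ := by linarith [sq_nonneg β]
  have hτB : 16 * B ≤ τ := by linarith
  have hβτ1 : β ≤ τ := hββ.trans hβτ'
  obtain ⟨h, L, N, hh, hN, hL, hexp⟩ := exists_discretization hτ hd hJ (Nat.div_le_self K τ)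
    hB1 hβ0 hβτ' hδ hl2 (Real.log_le_log (by linarith) hXτ) (Real.log_le_log (by linarith) hXB)
    (Real.log_le_log (by linarith) hXK) hβl
  refine le_probRegretLe_of_forall hlin hτ π' hJ hδ (fun H hH =>
    (avg_indicator_not_goodBatch_le hlin hτ hw η hβ0 hh ?_ hN ?_ hL H hH).trans hexp) ?_
  · refine (div_le_self hβ0.le (by linarith)).trans (hβτ1.trans ?_)
    rw [← hBdef]
    linarith [mul_le_mul_of_nonneg_left hB1 (by linarith : (0 : ℝ) ≤ τ)]
  · have h1 : √(d : ℝ) ≤ d := by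
      rw [Real.sqrt_le_left (by linarith)]
      exact le_self_pow₀ hd1 two_ne_zero
    have h2 : √(d : ℝ) * B ≤ d * B := mul_le_mul_of_nonneg_right h1 (by linarith)
    have h3 : d * B * 0.69 ≤ d * B * l := mul_le_mul_of_nonneg_left (by linarith) (by positivity)
    rw [← hBdef]
    linarith
  intro H hH hgood hwidth
  refine (regretSum_le_of_goodHistory hlin.1 hη hτ π' hw H hH hgood).trans ?_
  rw [regretBound, ← hq, ← hℓdef, hBsq, ← hBdef]
  -- Here the assumption `τ ≤ K/√τ` is what makes additive terms of order `τ` no larger than the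
  -- bonus term.
  have hKq : (τ : ℝ) ≤ K * q := by
    refine hτK.trans ?_
    rw [div_eq_mul_inv, ← Real.sqrt_inv]
    refine mul_le_mul_of_nonneg_left (Real.sqrt_le_sqrt ?_) (by linarith)
    rw [div_eq_mul_inv]
    exact le_mul_of_one_le_left (by positivity) hd1
  have hr : √(2 * d / τ) ≤ 3 / 2 * q := by
    rw [Real.sqrt_le_left (by positivity), mul_pow, hq2, mul_div_assoc]
    have : 0 ≤ (d : ℝ) / τ := by positivity
    linarith
  have hJτ : ((K / τ : ℕ) : ℝ) ≤ K / τ := Nat.cast_div_le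
  have hwidth2 : τ * sumWidth m Φ β η w H ≤ K * q * (3 + Real.log (1 / δ)) := by
    have h1 : ((K / τ : ℕ) : ℝ) * (2 * √(2 * d / τ)) ≤ K / τ * (3 * q) :=
      mul_le_mul hJτ (by linarith) (by positivity) (by positivity)
    have h2 := mul_le_mul_of_nonneg_left (hwidth.trans (add_le_add h1 le_rfl))
      (by linarith : (0 : ℝ) ≤ τ)
    have h3 : τ * (K / τ * (3 * q) + Real.log (1 / δ)) =
        K * q * 3 + τ * Real.log (1 / δ) := by
      field_simp
    have h4 := mul_le_mul_of_nonneg_right hKq (by linarith : 0 ≤ Real.log (1 / δ))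
    linarith
  -- The coefficient 12 of the theorem is split as 8 for the widths and 4 for the boundary terms `2B
  -- + 2τ`.
  have hwidth3 : 2 * τ * β * sumWidth m Φ β η w H ≤ 8 * β * (K * q) * ℓ := by
    have h1 : K * q * (3 + Real.log (1 / δ)) ≤ K * q * (4 * ℓ) :=
      mul_le_mul_of_nonneg_left (by linarith) (by positivity)
    have h2 := mul_le_mul_of_nonneg_left (hwidth2.trans h1) (by positivity : 0 ≤ 2 * β)
    linarith
  have hrest : 2 * B + 2 * τ ≤ 4 * β * (K * q) * ℓ := by
    have h1 : β * τ ≤ β * (K * q) := mul_le_mul_of_nonneg_left hKq hβ0.le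
    have h2 : β * (K * q) * 1 ≤ β * (K * q) * ℓ :=
      mul_le_mul_of_nonneg_left (by linarith) (by positivity)
    have h3 := mul_le_mul_of_nonneg_left hτ1 hβ0.le
    have h4 := mul_le_mul_of_nonneg_right (by linarith : 1 ≤ β) (by linarith : (0 : ℝ) ≤ τ)
    linarith
  -- Since `16B ≤ τ`, the policy-change error `8ηB³` is at most `τηB²/2`, the exponential-weights
  -- error itself.
  have hdrift : K / τ * (τ * η * B ^ 2 / 2 + 8 * η * B ^ 3) ≤ η * K * B ^ 2 := by
    have h1 : τ * η * B ^ 2 / 2 + 8 * η * B ^ 3 ≤ τ * (η * B ^ 2) := by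
      have := mul_le_mul_of_nonneg_left hτB (by positivity : 0 ≤ η * B ^ 2 / 2)
      linarith
    calc K / τ * (τ * η * B ^ 2 / 2 + 8 * η * B ^ 3) ≤ K / τ * (τ * (η * B ^ 2)) :=
          mul_le_mul_of_nonneg_left h1 (by positivity)
      _ = η * K * B ^ 2 := by field_simp
  linarith

end Main

/-! ### Choice of batch size and step size. -/

section Tuning

theorem probRegretLe_mono {S A : Type*} [Fintype S] [Fintype A] [Nonempty A] {d τ : ℕ}
    (m : MDP S A) (β η : ℝ) (Φ : Features S A d) (w : Adversary S A d τ) (π' : Policy S A)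
    (K : ℕ) {b c : ℝ} (h : b ≤ c) :
    probRegretLe m β η Φ w π' K b ≤ probRegretLe m β η Φ w π' K c :=
  MeasureTheory.measure_mono fun _ hH => le_trans hH h

set_option maxHeartbeats 1000000 in
/-- The regret bound for the batch size `⌊√K⌋`. -/
theorem regretBound_sqrt_le {d K nA : ℕ} (hd : 0 < d) (hK : 0 < K)
    {γ δ : ℝ} (hγ0 : 0 ≤ γ) (hγ1 : γ < 1) (hδ0 : 0 < δ) (hδ1 : δ < 1) :
    regretBound d nA K (Nat.sqrt K) γ (100 * explorationScale d K (Nat.sqrt K) γ δ)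
        ((1 - γ) * √(Nat.sqrt K * (1 + Real.log nA) / K)) δ ≤
      5000 * (d : ℝ) ^ (3 / 2 : ℝ) * √(1 + Real.log nA) / (1 - γ) ^ 2 * (K : ℝ) ^ (3 / 4 : ℝ) *
        Real.log (2 * K * d / (δ * (1 - γ))) ^ 2 := by
  have hγ : 0 < 1 - γ := by linarith
  obtain ⟨B, hB⟩ : ∃ B, B = (1 - γ)⁻¹ := ⟨_, rfl⟩
  have hγB : 1 - γ = B⁻¹ := by rw [hB, inv_inv]
  have hB1 : 1 ≤ B := hB ▸ (one_le_inv₀ hγ).mpr (by linarith)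
  have hB0 : 0 < B := by linarith
  -- In terms of `κ = K^{1/4}`, `t = √τ` and `α = √(1 + log|A|)`, one has `κ/2 ≤ t ≤ κ` and `η =
  -- αt/(Bκ²)`, so each term becomes a monomial to be compared with `κ³`.
  obtain ⟨κ, hκ⟩ : ∃ κ, κ = (K : ℝ) ^ (1 / 4 : ℝ) := ⟨_, rfl⟩
  have hK1 : (1 : ℝ) ≤ K := Nat.one_le_cast.mpr hK
  have hd1 : (1 : ℝ) ≤ d := Nat.one_le_cast.mpr hd
  have hκ1 : 1 ≤ κ := hκ ▸ Real.one_le_rpow hK1 (by norm_num)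
  have hκ0 : 0 < κ := by linarith
  have hκ4 : (K : ℝ) = κ ^ 4 := by
    rw [hκ, ← Real.rpow_natCast, ← Real.rpow_mul (by linarith)]
    norm_num
  have hκ3 : (K : ℝ) ^ (3 / 4 : ℝ) = κ ^ 3 := by
    rw [hκ, ← Real.rpow_natCast, ← Real.rpow_mul (by linarith)]
    norm_num
  have hd32 : (d : ℝ) ^ (3 / 2 : ℝ) = d * √d := by
    rw [show (3 / 2 : ℝ) = 1 + 1 / 2 by norm_num, Real.rpow_add (by linarith), Real.rpow_one,
      Real.sqrt_eq_rpow]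
  set τ := Nat.sqrt K with hτdef
  have hτ0 : 0 < τ := Nat.sqrt_pos.mpr hK
  have hτ1 : (1 : ℝ) ≤ τ := Nat.one_le_cast.mpr hτ0
  obtain ⟨t, ht⟩ : ∃ t, t = √(τ : ℝ) := ⟨_, rfl⟩
  have ht0 : 0 < t := ht ▸ Real.sqrt_pos.mpr (by linarith)
  have hτt : (τ : ℝ) = t ^ 2 := by rw [ht, Real.sq_sqrt (by linarith)]
  have hτκ : (τ : ℝ) ≤ κ ^ 2 := by
    have h1 : ((τ * τ : ℕ) : ℝ) ≤ K := Nat.cast_le.mpr (Nat.sqrt_le K)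
    push_cast at h1
    rw [hκ4] at h1
    exact le_of_sq_le_sq (by linarith) (by positivity)
  have htκ : t ≤ κ := by
    rw [hτt] at hτκ
    exact le_of_sq_le_sq hτκ hκ0.le
  have hκτ : κ ^ 2 ≤ 2 * τ := by
    have h1 : (K : ℝ) ≤ ((τ + 1) * (τ + 1) : ℕ) :=
      Nat.cast_le.mpr (Nat.lt_succ_sqrt K).le
    push_cast at h1
    rw [hκ4] at h1
    have h2 : ((τ : ℝ) + 1) ^ 2 ≤ (2 * τ) ^ 2 :=
      pow_le_pow_left₀ (by linarith) (by linarith) 2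
    exact le_of_sq_le_sq (by linarith) (by positivity)
  have hκt : κ ≤ 2 * t := by
    rw [hτt] at hκτ
    exact le_of_sq_le_sq (by linarith [sq_nonneg t]) (by positivity)
  obtain ⟨α, hα⟩ : ∃ α, α = √(1 + Real.log nA) := ⟨_, rfl⟩
  have hlogA : 0 ≤ Real.log nA := Real.log_natCast_nonneg _
  have hα1 : 1 ≤ α := hα ▸ Real.one_le_sqrt.mpr (by linarith)
  have hα0 : 0 < α := by linarith
  have hα2 : α ^ 2 = 1 + Real.log nA := by rw [hα, Real.sq_sqrt (by linarith)]
  obtain ⟨η, hη⟩ : ∃ η, η = (1 - γ) * √(τ * (1 + Real.log nA) / K) := ⟨_, rfl⟩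
  have hηeq : η = B⁻¹ * (α * t / κ ^ 2) := by
    rw [hη, hγB, ← hα2, hκ4, hτt, show t ^ 2 * α ^ 2 / κ ^ 4 = (α * t / κ ^ 2) ^ 2 by
      field_simp, Real.sqrt_sq (by positivity)]
  have hη0 : 0 < η := by
    rw [hηeq]
    positivity
  set l₂ := Real.log (2 * K * d / (δ * (1 - γ))) with hl₂
  have hlog2 := Real.log_two_gt_d9
  have hY : 2 * K * d / (δ * (1 - γ)) = 2 * K * d * B / δ := by
    rw [hB]
    field_simp
  have hKd : 1 ≤ (K : ℝ) * d := one_le_mul_of_one_le_of_one_le hK1 hd1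
  have hKdB : 1 ≤ (K : ℝ) * d * B := one_le_mul_of_one_le_of_one_le hKd hB1
  have hl₂1 : Real.log 2 ≤ l₂ := by
    refine Real.log_le_log two_pos ?_
    rw [hY, le_div_iff₀ hδ0]
    linarith
  have hτK : (τ : ℝ) ≤ K := Nat.cast_le.mpr (Nat.sqrt_le_self K)
  have hℓ : Real.log (2 * K * d / (τ * δ)) ≤ l₂ := by
    refine Real.log_le_log (by positivity) ?_
    rw [hY, div_le_div_iff₀ (by positivity) hδ0]
    have h1 : 1 ≤ B * τ := one_le_mul_of_one_le_of_one_le hB1 hτ1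
    have h2 := mul_le_mul_of_nonneg_left h1 (by positivity : 0 ≤ 2 * K * d * δ)
    linarith
  have hℓ0 : 0 ≤ Real.log (2 * K * d / (τ * δ)) := by
    refine Real.log_nonneg ?_
    rw [le_div_iff₀ (by positivity), one_mul]
    have h1 : τ * δ ≤ τ * 1 := mul_le_mul_of_nonneg_left hδ1.le (by linarith)
    have h2 : (K : ℝ) ≤ K * d := le_mul_of_one_le_right (by linarith) hd1
    linarith
  -- The argument is at most the square of `2Kd/(δ(1-γ))`, using `τ ≤ K`, `√d ≤ d` and `δ ≤ 1`.
  have hl : Real.log (τ * K * √d / (δ * (1 - γ)) * d / (1 - γ)) ≤ 2 * l₂ := by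
    have h0 : (2 : ℝ) * l₂ = Real.log ((2 * K * d * B / δ) ^ 2) := by
      rw [Real.log_pow, hl₂, hY]
      norm_num
    rw [h0, show τ * K * √d / (δ * (1 - γ)) * d / (1 - γ) = τ * K * √d * d * B ^ 2 / δ by
      rw [hB]
      field_simp]
    refine Real.log_le_log (by positivity) ?_
    rw [div_pow, div_le_div_iff₀ hδ0 (by positivity)]
    have h1 : √(d : ℝ) ≤ d := by
      rw [Real.sqrt_le_left (by linarith)]
      exact le_self_pow₀ hd1 two_ne_zero
    have h2 : τ * K * √d * d * B ^ 2 ≤ K * K * d * d * B ^ 2 := by gcongr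
    have h3 : δ ^ 2 ≤ δ := pow_le_of_le_one hδ0.le hδ1.le two_ne_zero
    calc τ * K * √d * d * B ^ 2 * δ ^ 2 ≤ K * K * d * d * B ^ 2 * δ :=
          mul_le_mul h2 h3 (by positivity) (by positivity)
      _ ≤ (2 * K * d * B) ^ 2 * δ := by
          refine mul_le_mul_of_nonneg_right ?_ hδ0.le
          have : 0 ≤ ((K : ℝ) * d * B) ^ 2 := by positivity
          linarith
  -- the five terms of the bound
  have hκ23 : κ ^ 2 ≤ κ ^ 3 := pow_le_pow_right₀ hκ1 (by norm_num)
  have hBB : B ≤ B ^ 2 := le_self_pow₀ hB1 two_ne_zero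
  have hu : α * κ ^ 3 * B ≤ α * κ ^ 3 * B ^ 2 := mul_le_mul_of_nonneg_left hBB (by positivity)
  have htκ3 : t * κ ^ 2 ≤ κ ^ 3 := by
    rw [pow_succ' κ 2]
    exact mul_le_mul_of_nonneg_right htκ (by positivity)
  have term1 : τ * Real.log nA / η ≤ α * κ ^ 3 * B := by
    calc τ * Real.log nA / η ≤ τ * α ^ 2 / η := by
          refine div_le_div_of_nonneg_right ?_ hη0.le
          exact mul_le_mul_of_nonneg_left (by linarith) (by linarith)
      _ = α * (t * κ ^ 2) * B := by
          rw [hηeq, hτt]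
          field_simp
      _ ≤ α * κ ^ 3 * B := by gcongr
  have term2 : (τ + 1) / (1 - γ) ≤ 2 * (α * κ ^ 3 * B) := by
    rw [div_eq_mul_inv, ← hB]
    have h1 : κ ^ 3 ≤ α * κ ^ 3 := le_mul_of_one_le_left (by positivity) hα1
    have h2 : (τ : ℝ) + 1 ≤ 2 * (α * κ ^ 3) := by linarith [one_le_pow₀ hκ1 (n := 3)]
    linarith [mul_le_mul_of_nonneg_right h2 hB0.le]
  have term3 : η * K / (1 - γ) ^ 2 ≤ α * κ ^ 3 * B := by
    calc η * K / (1 - γ) ^ 2 = α * (t * κ ^ 2) * B := by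
          rw [hηeq, hγB, hκ4]
          field_simp
      _ ≤ α * κ ^ 3 * B := by gcongr
  -- The constant is `4800 = 12 · 100 · 2 · 2`: one 2 from comparing the logarithms, one from `κ ≤
  -- 2t`.
  have term4 : 12 * (100 * explorationScale d K τ γ δ) * K * √(d / τ) *
      Real.log (2 * K * d / (τ * δ)) ≤ 4800 * (d * √d * (B ^ 2 * κ ^ 3 * l₂ ^ 2)) := by
    have h1 : explorationScale d K τ γ δ ≤ d * B * (2 * l₂) := by
      rw [explorationScale, div_eq_mul_inv (d : ℝ), ← hB]
      exact mul_le_mul_of_nonneg_left hl (by positivity)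
    have h2 : K * √((d : ℝ) / τ) ≤ √d * (2 * κ ^ 3) := by
      rw [Real.sqrt_div (by linarith), ← ht, hκ4, mul_div_assoc', div_le_iff₀ ht0]
      have := mul_le_mul_of_nonneg_left hκt (by positivity : 0 ≤ √(d : ℝ) * κ ^ 3)
      linarith
    calc 12 * (100 * explorationScale d K τ γ δ) * K * √(d / τ) *
          Real.log (2 * K * d / (τ * δ))
        = 1200 * (explorationScale d K τ γ δ *
            (K * √(d / τ) * Real.log (2 * K * d / (τ * δ)))) := by ring
      _ ≤ 1200 * (d * B * (2 * l₂) *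
            (K * √(d / τ) * Real.log (2 * K * d / (τ * δ)))) := by gcongr
      _ ≤ 1200 * (d * B * (2 * l₂) * (√d * (2 * κ ^ 3) * l₂)) := by
          have : 0 ≤ l₂ := by linarith
          gcongr
      _ = 4800 * (d * √d * (B * κ ^ 3 * l₂ ^ 2)) := by ring
      _ ≤ 4800 * (d * √d * (B ^ 2 * κ ^ 3 * l₂ ^ 2)) := by gcongr
  have term5 : √(2 * η) * K / ((1 - γ) ^ 2 * τ) ≤ 4 * (α * κ ^ 3 * B ^ 2) := by
    have h1 : √(2 * η) ≤ 2 * α := by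
      rw [Real.sqrt_le_left (by positivity)]
      have h2 : η ≤ α := by
        rw [hηeq]
        have h3 : t / κ ^ 2 ≤ 1 := by
          rw [div_le_one (by positivity)]
          exact htκ.trans (le_self_pow₀ hκ1 two_ne_zero)
        calc B⁻¹ * (α * t / κ ^ 2) ≤ 1 * (α * t / κ ^ 2) :=
              mul_le_mul_of_nonneg_right (inv_le_one_of_one_le₀ hB1) (by positivity)
          _ = α * (t / κ ^ 2) := by ring
          _ ≤ α * 1 := mul_le_mul_of_nonneg_left h3 hα0.le
          _ = α := mul_one α
      have h3 : α ≤ α ^ 2 := le_self_pow₀ hα1 two_ne_zero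
      linarith [sq_nonneg α]
    have h2 : (K : ℝ) / τ ≤ 2 * κ ^ 2 := by
      rw [div_le_iff₀ (by linarith), hκ4]
      linarith [mul_le_mul_of_nonneg_left hκτ (sq_nonneg κ)]
    calc √(2 * η) * K / ((1 - γ) ^ 2 * τ) = √(2 * η) * (K / τ) * B ^ 2 := by
          rw [hγB]
          field_simp
      _ ≤ 2 * α * (2 * κ ^ 2) * B ^ 2 := by gcongr
      _ ≤ 2 * α * (2 * κ ^ 3) * B ^ 2 := by gcongr
      _ = 4 * (α * κ ^ 3 * B ^ 2) := by ring
  -- The four terms without a logarithm add up to at most `8ακ³B²`. Inserting `l₂²` costs `8/0.48 <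
  -- 17`, and `4800 + 17 < 5000`.
  have hl₂2 : 0.48 ≤ l₂ ^ 2 := by
    have h1 : (0.693 : ℝ) ^ 2 ≤ l₂ ^ 2 := pow_le_pow_left₀ (by norm_num) (by linarith) 2
    linarith
  have hdd : 1 ≤ d * √(d : ℝ) :=
    one_le_mul_of_one_le_of_one_le hd1 (Real.one_le_sqrt.mpr hd1)
  have hall : α * κ ^ 3 * B ^ 2 * 0.48 ≤ d * √d * (α * κ ^ 3 * B ^ 2 * l₂ ^ 2) :=
    (mul_le_mul_of_nonneg_left hl₂2 (by positivity)).trans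
      (le_mul_of_one_le_left (by positivity) hdd)
  have hα4 : d * √d * (B ^ 2 * κ ^ 3 * l₂ ^ 2) ≤ d * √d * (α * κ ^ 3 * B ^ 2 * l₂ ^ 2) := by
    refine mul_le_mul_of_nonneg_left ?_ (by positivity)
    calc B ^ 2 * κ ^ 3 * l₂ ^ 2 ≤ α * (B ^ 2 * κ ^ 3 * l₂ ^ 2) :=
          le_mul_of_one_le_left (by positivity) hα1
      _ = _ := by ring
  have hfin : 5000 * (d * √(d : ℝ)) * α / (1 - γ) ^ 2 * κ ^ 3 * l₂ ^ 2 =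
      5000 * (d * √d * (α * κ ^ 3 * B ^ 2 * l₂ ^ 2)) := by
    rw [hγB]
    field_simp
  rw [regretBound, ← hη, ← hα, hκ3, hd32, hfin]
  refine (add_le_add (add_le_add (add_le_add (add_le_add term1 term2) term3) term4)
    term5).trans ?_
  clear term1 term2 term3 term4 term5 hfin
  have h0 : 0 ≤ α * κ ^ 3 * B ^ 2 := by positivity
  generalize α * κ ^ 3 * B ^ 2 = a at *
  generalize α * κ ^ 3 * B = b at *
  generalize (d : ℝ) * √d * (B ^ 2 * κ ^ 3 * l₂ ^ 2) = c at *
  generalize (d : ℝ) * √d * (a * l₂ ^ 2) = e at *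
  linarith

end Tuning

end

end AdvLinMDP

theorem mainTheorem4 :
    ∃ C C' : ℝ, 0 < C ∧ 0 < C' ∧
      ∀ (S A : Type*) [Fintype S] [Fintype A] [Nonempty A] (d : ℕ)
        (m : AdvLinMDP.MDP S A) (Φ : AdvLinMDP.Features S A d), AdvLinMDP.IsLinear m Φ →
      ∀ (K : ℕ) (δ : ℝ), 0 < K → 0 < δ → δ < 1 →
        (∀ τ : ℕ, 0 < τ → (τ : ℝ) ≤ K / √τ →
          ∀ η : ℝ, 0 < η →
          ∀ β : ℝ, C * AdvLinMDP.explorationScale d K τ m.γ δ ≤ β →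
          ∀ w : AdvLinMDP.Adversary S A d τ, (∀ k < K, ∀ H, ‖w k H‖ ≤ 1) →
          ∀ π' : AdvLinMDP.Policy S A,
            ENNReal.ofReal (1 - 2 * δ) ≤
              AdvLinMDP.probRegretLe m β η Φ w π' K
                (AdvLinMDP.regretBound d (Fintype.card A) K τ m.γ β η δ)) ∧
        (∀ w : AdvLinMDP.Adversary S A d (Nat.sqrt K), (∀ k < K, ∀ H, ‖w k H‖ ≤ 1) →
          ∀ π' : AdvLinMDP.Policy S A,
            ENNReal.ofReal (1 - 2 * δ) ≤
              AdvLinMDP.probRegretLe m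
                (C * AdvLinMDP.explorationScale d K (Nat.sqrt K) m.γ δ)
                ((1 - m.γ) * √(Nat.sqrt K * (1 + Real.log (Fintype.card A)) / K))
                Φ w π' K
                (C' * (d : ℝ) ^ (3 / 2 : ℝ) * √(1 + Real.log (Fintype.card A)) / (1 - m.γ) ^ 2
                  * (K : ℝ) ^ (3 / 4 : ℝ)
                  * Real.log (2 * K * d / (δ * (1 - m.γ))) ^ 2)) := by
  refine ⟨100, 5000, by norm_num, by norm_num, ?_⟩
  intro S A _ _ _ d m Φ hlin K δ hK hδ0 hδ1
  refine ⟨fun τ hτ hτK η hη β hβ w hw π' =>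
    AdvLinMDP.le_probRegretLe_regretBound hlin hK hδ0 hτ hτK hη hβ hw π', fun w hw π' => ?_⟩
  have hK1 : (1 : ℝ) ≤ K := Nat.one_le_cast.mpr hK
  have hτ : 0 < Nat.sqrt K := Nat.sqrt_pos.mpr hK
  have hτ1 : (1 : ℝ) ≤ Nat.sqrt K := Nat.one_le_cast.mpr hτ
  have hγ : 0 < 1 - m.γ := by linarith [m.γ_lt_one]
  have hlogA : 0 ≤ Real.log (Fintype.card A) := Real.log_natCast_nonneg _
  have hη : 0 < (1 - m.γ) * √(Nat.sqrt K * (1 + Real.log (Fintype.card A)) / K) := by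
    positivity
  -- The batch size is admissible since `τ√τ ≤ τ² ≤ K`.
  have hτK : (Nat.sqrt K : ℝ) ≤ K / √(Nat.sqrt K : ℝ) := by
    rw [le_div_iff₀ (by positivity)]
    have h1 : ((Nat.sqrt K * Nat.sqrt K : ℕ) : ℝ) ≤ K := Nat.cast_le.mpr (Nat.sqrt_le K)
    push_cast at h1
    have h2 : √(Nat.sqrt K : ℝ) ≤ Nat.sqrt K := by
      rw [Real.sqrt_le_left (by linarith)]
      exact le_self_pow₀ hτ1 two_ne_zero
    exact (mul_le_mul_of_nonneg_left h2 (by linarith)).trans h1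
  exact (AdvLinMDP.le_probRegretLe_regretBound hlin hK hδ0 hτ hτK hη le_rfl hw π').trans
    (AdvLinMDP.probRegretLe_mono m _ _ Φ w π' K (AdvLinMDP.regretBound_sqrt_le
      (AdvLinMDP.dim_pos_of_isLinear hlin) hK m.γ_nonneg m.γ_lt_one hδ0 hδ1))
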